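/- Let $\mathbb K$ be an algebraically closed field of characteristic $0$; algebras are $\mathbb K$-algebras with identity. An *antiassociative quasialgebra* is a not necessarily associative $\mathbb Z_2$-graded algebra $A=A_{\bar 0}\oplus A_{\bar 1}$ with $(xy)z=(-1)^{ijk}\,x(yz)$ for $x\in A_i$, $y\in A_j$, $z\in A_k$. A unit is an element having a left inverse and a right inverse. $A$ is a *quasicrossed product* of $\mathbb Z_2$ over $A_{\bar 0}$ if both $A_{\bar 0}$ and $A_{\bar 1}$ contain a unit of $A$; it is *simple* if $A^2\neq 0$ and its only graded two-sided ideals are $0$ and $A$. A *division antiassociative quasialgebra* is a nonzero antiassociative quasialgebra in which every nonzero homogeneous element is a unit. Isomorphisms of graded algebras are $\mathbb K$-algebra isomorphisms preserving the grading. For a division antiassociative quasialgebra $\Delta$, let $\mathrm{Mat}_n(\Delta)$ be the algebra of $n\times n$ matrices over $\Delta$ with the usual matrix product, graded by $\mathrm{Mat}_n(\Delta)_i=\mathrm{Mat}_n(\Delta_i)$. For an associative division algebra $D$ over $\mathbb K$, let $\widetilde{\mathrm{Mat}}_{n,m}(D)$ be the space of block matrices $\begin{pmatrix} a&v\\ w&b\end{pmatrix}$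 with $a\in \mathrm{Mat}_n(D)$, $b\in \mathrm{Mat}_m(D)$, $v\in \mathrm{Mat}_{n\times m}(D)$, $w\in \mathrm{Mat}_{m\times n}(D)$, with product $$\begin{pmatrix} a_1&v_1\\ w_1&b_1\end{pmatrix}\cdot\begin{pmatrix} a_2&v_2\\ w_2&b_2\end{pmatrix}=\begin{pmatrix} a_1a_2+v_1w_2& a_1v_2+v_1b_2\\ w_1a_2+b_1w_2& -w_1v_2+b_1b_2\end{pmatrix},$$ even part given by $v=0,\ w=0$, and odd part given by $a=0,\ b=0$. **Theorem.** Let $A$ be an antiassociative quasialgebra which is a simple quasicrossed product of $\mathbb Z_2$ over $A_{\bar 0}$, and suppose that the associative algebra $A_{\bar 0}$ is left Artinian (for instance, $A$ finite-dimensional or $A_{\bar 0}$ semisimple). Then $A$ is isomorphic, as a graded algebra, to exactly one of the following two types: 1. $\mathrm{Mat}_n(\Delta)$ for some $n\ge 1$ and some division antiassociative quasialgebra $\Delta$; 2. $\widetilde{\mathrm{Mat}}_{n,m}(D)$ for some $n,m\ge 1$ and some associative division algebra $D$ over $\mathbb K$. Moreover, in case 1 the number $n$ is uniquely determined by $A$,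 and $\Delta$ is unique up to isomorphism of graded algebras; in case 2 the numbers $n$ and $m$ are uniquely determined by $A$, and $D$ is unique up to isomorphism of $\mathbb K$-algebras. -/

import Mathlib

/-! Unital (not necessarily associative) algebras over a field `K` are types `A` with
`[NonAssocRing A] [Module K A] [IsScalarTower K A A] [SMulCommClass K A A]`.
The grading group `G` is written additively. -/

universe u v

section Quasialgebra

variable {G : Type*} [AddGroup G] {K : Type*} [Field K]

/-- A (normalized, invertible) 3-cocycle of `G` with values in `Kˣ`. -/
structure IsCocycle (φ : G → G → G → Kˣ) : Prop where
  cocycle : ∀ g h k l : G,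
    φ h k l * φ g (h + k) l * φ g h k = φ g h (k + l) * φ (g + h) k l
  normalized : ∀ g h : G, φ g 0 h = 1

/-- The family of subspaces `𝒜` makes `A` a `G`-graded quasialgebra with cocycle `φ`. -/
structure IsGradedQuasialgebra [DecidableEq G] {A : Type*} [NonAssocRing A] [Module K A]
    (φ : G → G → G → Kˣ) (𝒜 : G → Submodule K A) : Prop where
  isCocycle : IsCocycle φ
  isInternal : DirectSum.IsInternal 𝒜
  mul_mem : ∀ g h : G, ∀ x ∈ 𝒜 g, ∀ y ∈ 𝒜 h, x * y ∈ 𝒜 (g + h)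
  quasiassoc : ∀ g h k : G, ∀ x ∈ 𝒜 g, ∀ y ∈ 𝒜 h, ∀ z ∈ 𝒜 k,
    (x * y) * z = (φ g h k : K) • (x * (y * z))

/-- A unit of a non-associative algebra: an element with a left and a right inverse
(which may differ). -/
def IsTwoSidedUnit {A : Type*} [NonAssocRing A] (u : A) : Prop :=
  (∃ l : A, l * u = 1) ∧ (∃ r : A, u * r = 1)

/-- Every homogeneous component contains a unit: for a graded quasialgebra this says that it
is a quasicrossed product of `G` over its neutral component. -/
def IsQuasicrossedProduct {A : Type*} [NonAssocRing A] [Module K A]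
    (𝒜 : G → Submodule K A) : Prop :=
  ∀ g : G, ∃ u ∈ 𝒜 g, IsTwoSidedUnit u

/-- `I` is a graded (two-sided) ideal of `A`. -/
structure IsGradedIdeal {A : Type*} [NonAssocRing A] [Module K A]
    (𝒜 : G → Submodule K A) (I : Submodule K A) : Prop where
  graded : I = ⨆ g, I ⊓ 𝒜 g
  mul_mem_left : ∀ a : A, ∀ x ∈ I, a * x ∈ I
  mul_mem_right : ∀ a : A, ∀ x ∈ I, x * a ∈ I

/-- Simplicity in the graded sense: `A² ≠ 0`, and `0` and `A` are the only graded ideals. -/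
structure IsGradedSimple {A : Type*} [NonAssocRing A] [Module K A]
    (𝒜 : G → Submodule K A) : Prop where
  sq_ne_zero : ∃ x y : A, x * y ≠ 0
  eq_bot_or_eq_top : ∀ I : Submodule K A, IsGradedIdeal 𝒜 I → I = ⊥ ∨ I = ⊤

/-- The descending chain condition for the left ideals of the neutral component `𝒜 0`.
(A left ideal of the unital algebra `𝒜 0` is automatically a `K`-subspace.) -/
def NeutralPartArtinian {A : Type*} [NonAssocRing A] [Module K A]
    (𝒜 : G → Submodule K A) : Prop :=
  WellFoundedLT {I : Submodule K A // I ≤ 𝒜 0 ∧ ∀ a ∈ 𝒜 0, ∀ x ∈ I, a * x ∈ I}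

/-- Isomorphism of graded algebras over `K` (a multiplicative bijection between unital
algebras preserves the identity element). -/
def GradedIso {A B : Type*} [NonAssocRing A] [Module K A] [NonAssocRing B] [Module K B]
    (𝒜 : G → Submodule K A) (ℬ : G → Submodule K B) : Prop :=
  ∃ f : A ≃ₗ[K] B, (∀ x y : A, f (x * y) = f x * f y) ∧
    ∀ g : G, (𝒜 g).map (f : A →ₗ[K] B) = ℬ g

/-- The grading on the `n × n` matrices over `Δ` inherited from a grading of `Δ`: a matrix is
homogeneous of degree `g` if all its entries are. -/
def matrixGrading {Δ : Type*} [NonAssocRing Δ] [Module K Δ] (n : ℕ)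
    (𝒟 : G → Submodule K Δ) (g : G) : Submodule K (Matrix (Fin n) (Fin n) Δ) where
  carrier := {M | ∀ i j, M i j ∈ 𝒟 g}
  add_mem' hM hN i j := (𝒟 g).add_mem (hM i j) (hN i j)
  zero_mem' _ _ := (𝒟 g).zero_mem
  smul_mem' c _ hM i j := (𝒟 g).smul_mem c (hM i j)

end Quasialgebra

section Antiassociative

/-- The cocycle `φ(x,y,z) = (-1)^{xyz}` on `ℤ/2`. -/
def antiassocCocycle (K : Type*) [Field K] (x y z : ZMod 2) : Kˣ :=
  (-1) ^ (x.val * y.val * z.val)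

theorem antiassocCocycle_isCocycle (K : Type*) [Field K] :
    IsCocycle (antiassocCocycle K) := by
  constructor
  · intro g h k l
    have key : ∀ g h k l : ZMod 2,
        (h.val * k.val * l.val + g.val * (h + k).val * l.val + g.val * h.val * k.val) % 2 =
          (g.val * h.val * (k + l).val + (g + h).val * k.val * l.val) % 2 := by decide
    simp only [antiassocCocycle, ← pow_add]
    apply Units.ext
    push_cast
    rw [neg_one_pow_eq_pow_mod_two, key, ← neg_one_pow_eq_pow_mod_two]
  · intro g h
    simp [antiassocCocycle]

/-- An antiassociative quasialgebra: a `ℤ/2`-graded quasialgebra with cocycle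
`(-1)^{xyz}`. -/
def IsAntiassociativeQuasialgebra {K A : Type*} [Field K] [NonAssocRing A] [Module K A]
    (𝒜 : ZMod 2 → Submodule K A) : Prop :=
  IsGradedQuasialgebra (antiassocCocycle K) 𝒜

/-- A division antiassociative quasialgebra: nonzero, and every nonzero homogeneous element
is a unit. -/
structure IsDivisionAntiassociative {K Δ : Type*} [Field K] [NonAssocRing Δ] [Module K Δ]
    (𝒟 : ZMod 2 → Submodule K Δ) : Prop where
  antiassociative : IsAntiassociativeQuasialgebra 𝒟
  nontrivial : Nontrivial Δ
  isUnit : ∀ g : ZMod 2, ∀ x ∈ 𝒟 g, x ≠ 0 → IsTwoSidedUnit x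

end Antiassociative

section Chess

/-- The underlying space of the chess-board graded algebra: block matrices
`(a v; w b)` of size `(n + m) × (n + m)` over `D`. -/
@[ext]
structure ChessMat (n m : ℕ) (D : Type*) where
  a : Matrix (Fin n) (Fin n) D
  v : Matrix (Fin n) (Fin m) D
  w : Matrix (Fin m) (Fin n) D
  b : Matrix (Fin m) (Fin m) D

namespace ChessMat

variable {n m : ℕ} {D : Type*}

/-- A block matrix is the tuple of its blocks. -/
def equivProd : ChessMat n m D ≃
    Matrix (Fin n) (Fin n) D × Matrix (Fin n) (Fin m) D ×
      Matrix (Fin m) (Fin n) D × Matrix (Fin m) (Fin m) D where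
  toFun x := (x.a, x.v, x.w, x.b)
  invFun p := ⟨p.1, p.2.1, p.2.2.1, p.2.2.2⟩
  left_inv _ := rfl
  right_inv _ := rfl

variable [DivisionRing D]

instance : AddCommGroup (ChessMat n m D) := equivProd.addCommGroup

instance {K : Type*} [Field K] [Algebra K D] : Module K (ChessMat n m D) :=
  equivProd.module K

instance : Mul (ChessMat n m D) where
  mul x y :=
    ⟨x.a * y.a + x.v * y.w, x.a * y.v + x.v * y.b,
     x.w * y.a + x.b * y.w, -(x.w * y.v) + x.b * y.b⟩

instance : One (ChessMat n m D) where
  one := ⟨1, 0, 0, 1⟩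

@[simp] theorem zero_def : (0 : ChessMat n m D) = ⟨0, 0, 0, 0⟩ := rfl

theorem one_def : (1 : ChessMat n m D) = ⟨1, 0, 0, 1⟩ := rfl

theorem add_def (x y : ChessMat n m D) :
    x + y = ⟨x.a + y.a, x.v + y.v, x.w + y.w, x.b + y.b⟩ := rfl

theorem smul_def {K : Type*} [Field K] [Algebra K D] (c : K) (x : ChessMat n m D) :
    c • x = ⟨c • x.a, c • x.v, c • x.w, c • x.b⟩ := rfl

theorem mul_def (x y : ChessMat n m D) :
    x * y = ⟨x.a * y.a + x.v * y.w, x.a * y.v + x.v * y.b,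
      x.w * y.a + x.b * y.w, -(x.w * y.v) + x.b * y.b⟩ := rfl

instance : NonAssocRing (ChessMat n m D) :=
  { (inferInstance : AddCommGroup (ChessMat n m D)) with
    mul := (· * ·)
    one := 1
    left_distrib := fun x y z => by
      simp only [mul_def, add_def, Matrix.mul_add]
      ext1 <;> simp only <;> abel
    right_distrib := fun x y z => by
      simp only [mul_def, add_def, Matrix.add_mul]
      ext1 <;> simp only <;> abel
    zero_mul := fun x => by simp [mul_def]
    mul_zero := fun x => by simp [mul_def]
    one_mul := fun x => by simp [mul_def, one_def]
    mul_one := fun x => by simp [mul_def, one_def] }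

instance {K : Type*} [Field K] [Algebra K D] :
    IsScalarTower K (ChessMat n m D) (ChessMat n m D) where
  smul_assoc c x y := by
    simp only [smul_eq_mul, mul_def, smul_def, Matrix.smul_mul, smul_add, smul_neg]

instance {K : Type*} [Field K] [Algebra K D] :
    SMulCommClass K (ChessMat n m D) (ChessMat n m D) where
  smul_comm c x y := by
    simp only [smul_eq_mul, mul_def, smul_def, Matrix.mul_smul, smul_add, smul_neg]

/-- The chess-board grading: block-diagonal matrices are even, block-antidiagonal matrices
are odd. -/
def grading (K : Type*) [Field K] (n m : ℕ) (D : Type*) [DivisionRing D] [Algebra K D]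
    (g : ZMod 2) : Submodule K (ChessMat n m D) where
  carrier := {x | if g = 0 then x.v = 0 ∧ x.w = 0 else x.a = 0 ∧ x.b = 0}
  add_mem' {x y} hx hy := by
    simp only [Set.mem_ofPred_eq] at *
    split_ifs at * <;> simp [add_def, hx, hy]
  zero_mem' := by
    simp
  smul_mem' c x hx := by
    simp only [Set.mem_ofPred_eq] at *
    split_ifs at * <;> simp [smul_def, hx]

end ChessMat

end Chess

/-! The even part `E = A₀` of an antiassociative quasialgebra is contained in the nucleus of `A`,
because the sign `(-1)^{ijk}` is trivial as soon as one degree is. So `E` is an associative algebra,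
and idempotents, matrix units and corners of `E` can be used in `A` as in an associative algebra.

*Existence.* Let `u` be an odd unit. Then `A = E ⊕ E u`, and `u a = σ(a) u` defines an automorphism
`σ` of `E` whose square is conjugation by `u * u`. A `σ`-stable ideal `J` of `E` gives the graded
ideal `J + J u` of `A`, so graded simplicity leaves only `J = 0` and `J = E`
(`IsOddUnit.eq_bot_or_one_mem`). Applied to the Jacobson radical, this makes `E` semisimple. Let `ε`
be the identity of one Wedderburn block `Mat_n(D)` of `E`. Since `σ²` fixes central elements, either
`ε` or `ε + σ(ε)` is `σ`-invariant, hence equal to `1` (`IsMatrixBlock.one_eq_or`).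

* If `ε = 1`, the matrix units of `E = Mat_n(D)` exhibit `A` as `Mat_n(Δ)` with `Δ = e A e` for a
  primitive idempotent `e` (`gradedIso_matrix_nuclearCorner`). An odd `x ≠ 0` in `Δ` is invertible
  since `x u` is a nonzero element of the prime ring `E`
  (`isDivisionAntiassociative_nuclearCorner`).
* If `ε + σ(ε) = 1`, the odd elements `v = ε u` and `w = u⁻¹ ε`, where `u⁻¹` is the right inverse,
  satisfy `v w = ε` and `w v = -(1 - ε)`, the sign being that of the chess-board product. They
  carry the block of `ε` to the other three blocks (`gradedIso_chess`).

*Uniqueness.* The diagonal blocks of either model are two-sided ideals of `E` that are matrix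
algebras over division rings. Such an ideal has a minimal central idempotent as identity, so two of
them with nonzero product coincide. This separates the two models (`E` is one block or two), and
reduces the rest to an isomorphism `Mat_n(D) ≃ Mat_n'(D')`. It sends a primitive idempotent to
`x y` where `y x` is a given primitive idempotent (`Matrix.exists_mul_eq_single`); this yields
`n = n'` by the rank condition over `D'`, and conjugation by `x`, `y` identifies the two corners,
which are `D` and `D'` or, inside `A`, `Δ` and `Δ'` (`IsCornerMap.exists_linearEquiv`). In the
chess-board model the two block sizes agree because of the odd unit (`eq_of_gradedIso_chess`). -/

/-! ### Even elements and the nucleus -/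

/-- The elements of a nonassociative ring that associate with everything, in every position. -/
structure IsNuclear {A : Type*} [NonAssocRing A] (x : A) : Prop where
  left : ∀ y z : A, (x * y) * z = x * (y * z)
  mid : ∀ y z : A, (y * x) * z = y * (x * z)
  right : ∀ y z : A, (y * z) * x = y * (z * x)

namespace IsAntiassociativeQuasialgebra

variable {K A : Type*} [Field K] [NonAssocRing A] [Module K A] {𝒜 : ZMod 2 → Submodule K A}

theorem isCompl (h : IsAntiassociativeQuasialgebra 𝒜) : IsCompl (𝒜 0) (𝒜 1) :=
  (DirectSum.isInternal_submodule_iff_isCompl 𝒜 (i := 0) (j := 1) (by decide)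
    (by ext x; revert x; decide)).1 h.isInternal

theorem exists_add (h : IsAntiassociativeQuasialgebra 𝒜) (x : A) :
    ∃ a ∈ 𝒜 0, ∃ b ∈ 𝒜 1, a + b = x :=
  Submodule.mem_sup.1 (h.isCompl.sup_eq_top ▸ Submodule.mem_top)

theorem eq_zero (h : IsAntiassociativeQuasialgebra 𝒜) {x : A} (h0 : x ∈ 𝒜 0) (h1 : x ∈ 𝒜 1) :
    x = 0 :=
  Submodule.disjoint_def.1 h.isCompl.disjoint x h0 h1

theorem eq_of_add_eq (h : IsAntiassociativeQuasialgebra 𝒜) {a a' b b' : A} (ha : a ∈ 𝒜 0)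
    (ha' : a' ∈ 𝒜 0) (hb : b ∈ 𝒜 1) (hb' : b' ∈ 𝒜 1) (e : a + b = a' + b') :
    a = a' ∧ b = b' := by
  have e' : a - a' = b' - b := by
    rw [sub_eq_sub_iff_add_eq_add, e, add_comm]
  have := h.eq_zero ((𝒜 0).sub_mem ha ha') (e' ▸ (𝒜 1).sub_mem hb' hb)
  have h2 := this
  rw [e'] at h2
  exact ⟨sub_eq_zero.1 this, (sub_eq_zero.1 h2).symm⟩

theorem even_mul_even (h : IsAntiassociativeQuasialgebra 𝒜) {x y : A} (hx : x ∈ 𝒜 0)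
    (hy : y ∈ 𝒜 0) : x * y ∈ 𝒜 0 := h.mul_mem 0 0 x hx y hy

theorem even_mul_odd (h : IsAntiassociativeQuasialgebra 𝒜) {x y : A} (hx : x ∈ 𝒜 0)
    (hy : y ∈ 𝒜 1) : x * y ∈ 𝒜 1 := h.mul_mem 0 1 x hx y hy

theorem odd_mul_even (h : IsAntiassociativeQuasialgebra 𝒜) {x y : A} (hx : x ∈ 𝒜 1)
    (hy : y ∈ 𝒜 0) : x * y ∈ 𝒜 1 := h.mul_mem 1 0 x hx y hy

theorem odd_mul_odd (h : IsAntiassociativeQuasialgebra 𝒜) {x y : A} (hx : x ∈ 𝒜 1)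
    (hy : y ∈ 𝒜 1) : x * y ∈ 𝒜 0 := h.mul_mem 1 1 x hx y hy

/-- Even elements are nuclear: the sign `(-1)^{ijk}` is trivial as soon as one degree is. -/
theorem isNuclear (h : IsAntiassociativeQuasialgebra 𝒜) {x : A} (hx : x ∈ 𝒜 0) :
    IsNuclear x := by
  have key : ∀ i j : ZMod 2, ∀ y ∈ 𝒜 i, ∀ z ∈ 𝒜 j, (x * y) * z = x * (y * z) ∧
      (y * x) * z = y * (x * z) ∧ (y * z) * x = y * (z * x) := by
    intro i j y hy z hz
    refine ⟨?_, ?_, ?_⟩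
    · simpa [antiassocCocycle] using h.quasiassoc 0 i j x hx y hy z hz
    · simpa [antiassocCocycle] using h.quasiassoc i 0 j y hy x hx z hz
    · simpa [antiassocCocycle] using h.quasiassoc i j 0 y hy z hz x hx
  have full : ∀ y z : A, (x * y) * z = x * (y * z) ∧
      (y * x) * z = y * (x * z) ∧ (y * z) * x = y * (z * x) := by
    intro y z
    obtain ⟨y0, hy0, y1, hy1, rfl⟩ := h.exists_add y
    obtain ⟨z0, hz0, z1, hz1, rfl⟩ := h.exists_add z
    have k00 := key 0 0 y0 hy0 z0 hz0
    have k01 := key 0 1 y0 hy0 z1 hz1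
    have k10 := key 1 0 y1 hy1 z0 hz0
    have k11 := key 1 1 y1 hy1 z1 hz1
    simp only [mul_add, add_mul, k00, k01, k10, k11, and_self]
  exact ⟨fun y z => (full y z).1, fun y z => (full y z).2.1, fun y z => (full y z).2.2⟩

theorem odd_assoc (h : IsAntiassociativeQuasialgebra 𝒜) {x y z : A} (hx : x ∈ 𝒜 1)
    (hy : y ∈ 𝒜 1) (hz : z ∈ 𝒜 1) : (x * y) * z = -(x * (y * z)) := by
  simpa [antiassocCocycle, ZMod.val_one] using h.quasiassoc 1 1 1 x hx y hy z hz

theorem one_mem (h : IsAntiassociativeQuasialgebra 𝒜) : (1 : A) ∈ 𝒜 0 := by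
  obtain ⟨a, ha, b, hb, e⟩ := h.exists_add 1
  -- the odd component `b` of `1` annihilates every homogeneous element, hence also `1`
  have h0 : ∀ x ∈ 𝒜 0, b * x = 0 := fun x hx =>
    (h.eq_of_add_eq (h.even_mul_even ha hx) hx (h.odd_mul_even hb hx) (𝒜 1).zero_mem
      (by rw [← add_mul, e, one_mul, add_zero])).2
  have h1 : ∀ x ∈ 𝒜 1, b * x = 0 := fun x hx =>
    (h.eq_of_add_eq (h.odd_mul_odd hb hx) (𝒜 0).zero_mem (h.even_mul_odd ha hx) hx
      (by rw [← add_mul, add_comm b, e, one_mul, zero_add])).1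
  have hb0 : b = 0 := by
    rw [← mul_one b, ← e, mul_add, h0 a ha, h1 b hb, add_zero]
  rwa [← e, hb0, add_zero]

/-- The even part of an antiassociative quasialgebra, as an associative algebra. -/
def EvenPart (_ : IsAntiassociativeQuasialgebra 𝒜) : Type _ := 𝒜 0

namespace EvenPart

variable (h : IsAntiassociativeQuasialgebra 𝒜)

instance : AddCommGroup h.EvenPart := inferInstanceAs (AddCommGroup (𝒜 0))

instance : Module K h.EvenPart := inferInstanceAs (Module K (𝒜 0))

/-- The inclusion of the even part. -/
def val : h.EvenPart →ₗ[K] A := (𝒜 0).subtype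

variable {h} in
theorem val_injective : Function.Injective (val h) := Subtype.val_injective

variable {h} in
theorem val_mem (x : h.EvenPart) : val h x ∈ 𝒜 0 := x.2

/-- An even element, as an element of the even part. -/
def mk (x : A) (hx : x ∈ 𝒜 0) : h.EvenPart := ⟨x, hx⟩

@[simp] theorem val_mk (x : A) (hx : x ∈ 𝒜 0) : val h (mk h x hx) = x := rfl

instance : Mul h.EvenPart := ⟨fun x y => mk h (val h x * val h y) (h.even_mul_even x.2 y.2)⟩

instance : One h.EvenPart := ⟨mk h 1 h.one_mem⟩

variable {h} in
@[simp] theorem val_mul (x y : h.EvenPart) : val h (x * y) = val h x * val h y := rfl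

@[simp] theorem val_one : val h 1 = 1 := rfl

instance : Ring h.EvenPart :=
  { (inferInstance : AddCommGroup h.EvenPart) with
    mul := (· * ·)
    one := 1
    left_distrib := fun x y z => val_injective (by simp [mul_add])
    right_distrib := fun x y z => val_injective (by simp [add_mul])
    zero_mul := fun x => val_injective (by simp)
    mul_zero := fun x => val_injective (by simp)
    mul_assoc := fun x y z => val_injective (by simp [(h.isNuclear (val_mem x)).left])
    one_mul := fun x => val_injective (by simp)
    mul_one := fun x => val_injective (by simp) }

instance [IsScalarTower K A A] [SMulCommClass K A A] : Algebra K h.EvenPart :=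
  Algebra.ofModule (fun c x y => val_injective (by simp [smul_mul_assoc]))
    (fun c x y => val_injective (by simp [mul_smul_comm]))

end EvenPart

end IsAntiassociativeQuasialgebra

/-! ### Idempotents with division corners in prime rings -/

/-- In a prime ring, two idempotents `e`, `f` whose corners are division rings are equivalent:
`e = x * y` and `f = y * x` for some `x`, `y`. -/
theorem exists_mul_eq_of_prime {S : Type*} [Ring S]
    (prime : ∀ a b : S, a ≠ 0 → b ≠ 0 → ∃ r, a * r * b ≠ 0) {e f : S}
    (he : e * e = e) (hf : f * f = f) (he0 : e ≠ 0) (hf0 : f ≠ 0)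
    (hediv : ∀ z, e * z * e ≠ 0 → ∃ z', e * z * e * z' = e)
    (hfdiv : ∀ z, f * z * f ≠ 0 → ∃ z', f * z * f * z' = f) :
    ∃ x y : S, x * y = e ∧ y * x = f := by
  obtain ⟨r, hr⟩ := prime e f he0 hf0
  obtain ⟨x, hx⟩ : ∃ x, x = e * r * f := ⟨_, rfl⟩
  rw [← hx] at hr
  have hex : e * x = x := by rw [hx, ← mul_assoc, ← mul_assoc, he]
  have hxf : x * f = x := by rw [hx, mul_assoc, hf]
  obtain ⟨s, hs⟩ := prime x x hr hr
  obtain ⟨t, ht⟩ := hediv (x * s) (by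
    intro h0
    apply hs
    calc x * s * x = e * (x * s) * e * x := by
          simp only [mul_assoc, hex]
          rw [← mul_assoc e x, hex]
      _ = 0 := by rw [h0, zero_mul])
  obtain ⟨y, hy⟩ : ∃ y, y = f * s * e * t * e := ⟨_, rfl⟩
  have hxy : x * y = e := by
    calc x * y = (x * f) * s * e * t * e := by rw [hy]; simp only [mul_assoc]
      _ = e * (x * s) * e * t * e := by rw [hxf, ← mul_assoc e x s, hex]
      _ = e := by rw [ht, he]
  have hfy : f * y = y := by simp only [hy, ← mul_assoc, hf]
  have hye : y * e = y := by simp only [hy, mul_assoc, he]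
  refine ⟨x, y, hxy, ?_⟩
  -- `y * x` is a nonzero idempotent of the division ring `f S f`
  have hcorner : f * (y * x) * f = y * x := by
    rw [← mul_assoc, hfy, mul_assoc, hxf]
  have hidem : (y * x) * (y * x) = y * x := by
    rw [mul_assoc, ← mul_assoc x, hxy, hex]
  obtain ⟨z, hz⟩ := hfdiv (y * x) (by
    rw [hcorner]
    intro h0
    apply hr
    rw [← hex, ← hxy, mul_assoc, h0, mul_zero])
  rw [hcorner] at hz
  calc y * x = (y * x) * f := by rw [mul_assoc, hxf]
    _ = f := by rw [← hz, ← mul_assoc, hidem]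

/-! ### Matrix rings over division rings -/

section MatrixDivision

variable {n n' : ℕ} {D D' : Type*} [DivisionRing D] [DivisionRing D']

theorem Matrix.exists_mul_mul_ne_zero (a b : Matrix (Fin n) (Fin n) D) (ha : a ≠ 0) (hb : b ≠ 0) :
    ∃ r, a * r * b ≠ 0 := by
  obtain ⟨i, j, hij⟩ : ∃ i j, a i j ≠ 0 := by
    by_contra! hc
    exact ha (Matrix.ext hc)
  obtain ⟨k, l, hkl⟩ : ∃ i j, b i j ≠ 0 := by
    by_contra! hc
    exact hb (Matrix.ext hc)
  refine ⟨Matrix.single j k 1, fun h0 => ?_⟩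
  have := congr_fun (congr_fun h0 i) l
  simp [Matrix.mul_apply, Matrix.single_apply, Finset.sum_ite_eq, ite_and, hij, hkl] at this

theorem Matrix.single_diag_mul_mul_single_diag (i : Fin n) (a b : D)
    (z : Matrix (Fin n) (Fin n) D) :
    Matrix.single i i a * z * Matrix.single i i b = Matrix.single i i (a * z i i * b) := by
  ext k l
  by_cases hk : k = i <;> by_cases hl : l = i <;>
    simp [Matrix.mul_apply, Matrix.single_apply, @eq_comm _ i, hk, hl]

theorem Matrix.exists_inv_corner (i : Fin n) (z : Matrix (Fin n) (Fin n) D)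
    (hz : Matrix.single i i 1 * z * Matrix.single i i 1 ≠ 0) :
    ∃ z', Matrix.single i i 1 * z * Matrix.single i i 1 * z' = Matrix.single i i 1 := by
  rw [Matrix.single_diag_mul_mul_single_diag, one_mul, mul_one] at hz ⊢
  refine ⟨Matrix.single i i (z i i)⁻¹, ?_⟩
  rw [Matrix.single_mul_single_same, mul_inv_cancel₀]
  rintro h0
  simp [h0] at hz

theorem Matrix.single_one_ne_zero (i : Fin n) : (Matrix.single i i 1 : Matrix _ _ D) ≠ 0 := by
  intro h0
  simpa using congr_fun (congr_fun h0 i) i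

/-- Under an isomorphism of matrix rings, a primitive diagonal matrix unit is carried to an
idempotent equivalent to any primitive diagonal matrix unit. -/
theorem Matrix.exists_mul_eq_single (F : Matrix (Fin n) (Fin n) D ≃+* Matrix (Fin n') (Fin n') D')
    (i : Fin n) (i' : Fin n') :
    ∃ x y, x * y = F (Matrix.single i i 1) ∧ y * x = Matrix.single i' i' 1 := by
  refine exists_mul_eq_of_prime Matrix.exists_mul_mul_ne_zero ?_ (by simp) ?_
    (Matrix.single_one_ne_zero i') ?_ (Matrix.exists_inv_corner i')
  · rw [← map_mul, Matrix.single_mul_single_same, one_mul]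
  · rw [Ne, EmbeddingLike.map_eq_zero_iff]
    exact Matrix.single_one_ne_zero i
  · intro z hz
    obtain ⟨w, rfl⟩ := F.surjective z
    obtain ⟨w', hw'⟩ := Matrix.exists_inv_corner i w (by
      intro h0
      apply hz
      rw [← map_mul, ← map_mul, h0, map_zero])
    exact ⟨F w', by rw [← map_mul, ← map_mul, ← map_mul, hw']⟩

/-- If `x * y = F E₀₀` and `y * x = E₀₀`, the zeroth rows of the `y * F E₀ᵢ` and the zeroth
columns of the `F Eᵢ₀ * x` form rectangular matrices over `D'` with product `1`. -/
theorem Matrix.le_of_ringEquiv [NeZero n] [NeZero n']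
    (F : Matrix (Fin n) (Fin n) D ≃+* Matrix (Fin n') (Fin n') D') : n ≤ n' := by
  obtain ⟨x, y, hxy, hyx⟩ := Matrix.exists_mul_eq_single F 0 0
  refine rankCondition_iff_matrix.1 (inferInstance : RankCondition D') n' n
    (Matrix.of fun k j => (F (Matrix.single j 0 1) * x) k 0)
    (Matrix.of fun i k => (y * F (Matrix.single 0 i 1)) 0 k) ?_
  ext i j
  have : (y * F (Matrix.single 0 i 1) * (F (Matrix.single j 0 1) * x)) 0 0 =
      (1 : Matrix _ _ D') i j := by
    rw [mul_assoc, ← mul_assoc (F _), ← map_mul]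
    by_cases hij : i = j
    · subst hij
      rw [Matrix.single_mul_single_same, one_mul, ← hxy, mul_assoc x, hyx, ← mul_assoc, hyx,
        Matrix.single_mul_single_same]
      simp
    · rw [Matrix.single_mul_single_of_ne _ _ _ _ hij]
      simp [hij]
  rw [← this, Matrix.mul_apply, Matrix.mul_apply]
  rfl

theorem Matrix.eq_of_ringEquiv [NeZero n] [NeZero n']
    (F : Matrix (Fin n) (Fin n) D ≃+* Matrix (Fin n') (Fin n') D') : n = n' :=
  le_antisymm (Matrix.le_of_ringEquiv F) (Matrix.le_of_ringEquiv F.symm)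

theorem Matrix.eq_zero_or_one_of_central {z : Matrix (Fin n) (Fin n) D}
    (hz : z * z = z) (hc : ∀ w, z * w = w * z) : z = 0 ∨ z = 1 := by
  by_contra! hcon
  obtain ⟨r, hr⟩ := Matrix.exists_mul_mul_ne_zero z (1 - z) hcon.1 (sub_ne_zero.2 hcon.2.symm)
  apply hr
  rw [hc, mul_assoc, mul_sub, mul_one, hz, sub_self, mul_zero]

end MatrixDivision

/-! ### Corners -/

theorem IsNuclear.mul {A : Type*} [NonAssocRing A] {x y : A} (hx : IsNuclear x)
    (hy : IsNuclear y) : IsNuclear (x * y) where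
  left a b := by simp only [hx.left, hy.left]
  mid a b := by rw [← hx.mid, hy.mid, hx.mid, hx.left]
  right a b := by rw [← hx.mid, hx.right, hy.right, hx.mid]

/-- `κ` identifies `B` with the corner `e * A * e` of `A`, where `e = κ 1`. -/
structure IsCornerMap {K A B : Type*} [Field K] [NonAssocRing A] [Module K A] [NonAssocRing B]
    [Module K B] (κ : B →ₗ[K] A) : Prop where
  map_mul : ∀ x y, κ (x * y) = κ x * κ y
  injective : Function.Injective κ
  exists_eq : ∀ a : A, κ 1 * a = a → a * κ 1 = a → ∃ b, κ b = a

namespace IsCornerMap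

variable {K A B B' : Type*} [Field K] [NonAssocRing A] [Module K A]
  [NonAssocRing B] [Module K B] [NonAssocRing B'] [Module K B']
  {κ : B →ₗ[K] A} {κ' : B' →ₗ[K] A}

theorem one_mul_map (h : IsCornerMap κ) (b : B) : κ 1 * κ b = κ b := by
  rw [← h.map_mul, one_mul]

theorem map_mul_one (h : IsCornerMap κ) (b : B) : κ b * κ 1 = κ b := by
  rw [← h.map_mul, mul_one]

theorem exists_conj (h : IsCornerMap κ) (h' : IsCornerMap κ') {x y : A} (hx : IsNuclear x)
    (hy : IsNuclear y) (hxy : x * y = κ 1) (hyx : y * x = κ' 1) (b : B) :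
    ∃ b', κ' b' = y * (κ b * x) := by
  have hxy' : ∀ t, x * (y * t) = κ 1 * t := fun t => by rw [← hxy, hx.left]
  have he : IsNuclear (κ 1) := hxy ▸ hx.mul hy
  have hl : ∀ t, κ 1 * (κ b * t) = κ b * t := fun t => by rw [← he.left, h.one_mul_map]
  have hr : ∀ t, κ b * (κ 1 * t) = κ b * t := fun t => by rw [← he.mid, h.map_mul_one]
  apply h'.exists_eq
  · rw [← hyx]
    simp only [hy.left, hxy', hl]
  · rw [← hyx]
    simp only [hx.mid, hy.left, hxy', hr]

/-- Equivalent nuclear idempotents have isomorphic corners, by `b ↦ y * b * x`. -/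
theorem exists_linearEquiv [IsScalarTower K A A] [SMulCommClass K A A] (h : IsCornerMap κ)
    (h' : IsCornerMap κ') {x y : A} (hx : IsNuclear x) (hy : IsNuclear y)
    (hxy : x * y = κ 1) (hyx : y * x = κ' 1) :
    ∃ f : B ≃ₗ[K] B', (∀ a b, f (a * b) = f a * f b) ∧ (∀ b, κ' (f b) = y * (κ b * x)) ∧
      ∀ b, κ (f.symm b) = x * (κ' b * y) := by
  have hxy' : ∀ t, x * (y * t) = κ 1 * t := fun t => by rw [← hxy, hx.left]
  have hyx' : ∀ t, y * (x * t) = κ' 1 * t := fun t => by rw [← hyx, hy.left]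
  have he : IsNuclear (κ 1) := hxy ▸ hx.mul hy
  choose g hg using h.exists_conj h' hx hy hxy hyx
  choose g' hg' using h'.exists_conj h hy hx hyx hxy
  refine ⟨{ toFun := g, invFun := g', map_add' := fun a b => h'.injective ?_,
            map_smul' := fun c a => h'.injective ?_, left_inv := fun a => h.injective ?_,
            right_inv := fun a => h'.injective ?_ }, fun a b => h'.injective ?_, hg, hg'⟩
  · simp only [map_add, hg, mul_add, add_mul]
  · simp only [map_smul, hg, RingHom.id_apply, smul_mul_assoc, mul_smul_comm]
  · simp only [hg, hg', hx.mid, hy.left, hxy', hxy,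
      h.map_mul_one, h.one_mul_map]
  · simp only [hg, hg', hx.left, hy.mid, hyx', hyx,
      h'.map_mul_one, h'.one_mul_map]
  · change κ' (g (a * b)) = κ' (g a * g b)
    have hl : ∀ t, κ 1 * (κ b * t) = κ b * t := fun t => by rw [← he.left, h.one_mul_map]
    simp only [h'.map_mul, hg, h.map_mul, hx.mid, hx.right, hy.left, hxy', hl]

end IsCornerMap

/-- The corner of a matrix ring at a diagonal matrix unit is the coefficient ring. -/
theorem isCornerMap_single (K : Type*) [Field K] {n : ℕ} {B : Type*} [NonAssocRing B]
    [Module K B] (i : Fin n) :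
    IsCornerMap (Matrix.singleLinearMap K i i : B →ₗ[K] Matrix (Fin n) (Fin n) B) where
  map_mul x y := by
    ext k l
    by_cases hk : k = i <;> by_cases hl : l = i <;>
      simp [Matrix.mul_apply, Matrix.single_apply, @eq_comm _ i, hk, hl]
  injective := fun x y hxy => by simpa using congr_fun (congr_fun hxy i) i
  exists_eq a h1 h2 := by
    refine ⟨a i i, ?_⟩
    ext k l
    have e1 := congr_fun (congr_fun h1 k) l
    have e2 := congr_fun (congr_fun h2 k) l
    by_cases hk : k = i <;> by_cases hl : l = i <;>
      simp_all [Matrix.mul_apply, Matrix.single_apply, @eq_comm _ i]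

theorem Matrix.nonempty_algEquiv_of_algEquiv {K D D' : Type*} [Field K] [DivisionRing D]
    [DivisionRing D'] [Algebra K D] [Algebra K D'] {n n' : ℕ} [NeZero n] [NeZero n']
    (F : Matrix (Fin n) (Fin n) D ≃ₐ[K] Matrix (Fin n') (Fin n') D') :
    Nonempty (D ≃ₐ[K] D') := by
  obtain ⟨x, y, hxy, hyx⟩ := Matrix.exists_mul_eq_single F.toRingEquiv 0 0
  have hD := isCornerMap_single K (n := n) (B := D) 0
  have h : IsCornerMap (F.toLinearMap ∘ₗ (Matrix.singleLinearMap K 0 0 : D →ₗ[K] _)) :=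
    { map_mul := fun a b => by
        simp only [LinearMap.comp_apply, hD.map_mul, AlgEquiv.toLinearMap_apply, map_mul]
      injective := F.injective.comp hD.injective
      exists_eq := fun a h1 h2 => by
        obtain ⟨a, rfl⟩ := F.surjective a
        simp only [LinearMap.comp_apply, AlgEquiv.toLinearMap_apply, ← map_mul,
          EmbeddingLike.apply_eq_iff_eq] at h1 h2
        obtain ⟨b, hb⟩ := hD.exists_eq a h1 h2
        exact ⟨b, congrArg F hb⟩ }
  have nuc : ∀ z : Matrix (Fin n') (Fin n') D', IsNuclear z := fun z =>
    ⟨fun _ _ => mul_assoc _ _ _, fun _ _ => mul_assoc _ _ _, fun _ _ => mul_assoc _ _ _⟩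
  obtain ⟨f, hf, -⟩ := h.exists_linearEquiv (isCornerMap_single K 0) (nuc x) (nuc y) hxy hyx
  refine ⟨AlgEquiv.ofLinearEquiv f ?_ hf⟩
  have := hf 1 (f.symm 1)
  rw [one_mul, LinearEquiv.apply_symm_apply, mul_one] at this
  exact this.symm

/-! ### Matrix blocks -/

/-- `ι` identifies `Mat_n(D)` with a two-sided ideal of the associative algebra `R`. The
identity of this ideal is the central idempotent `ι 1`. -/
structure IsMatrixBlock {K R D : Type*} [Field K] [Ring R] [Algebra K R] [DivisionRing D]
    [Algebra K D] {n : ℕ} (ι : Matrix (Fin n) (Fin n) D →ₗ[K] R) : Prop where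
  map_mul : ∀ M N, ι (M * N) = ι M * ι N
  injective : Function.Injective ι
  mul_mem_left : ∀ x M, ∃ N, ι N = x * ι M
  mul_mem_right : ∀ x M, ∃ N, ι N = ι M * x

namespace IsMatrixBlock

variable {K R D D' : Type*} [Field K] [Ring R] [Algebra K R] [DivisionRing D] [Algebra K D]
  [DivisionRing D'] [Algebra K D'] {n n' : ℕ} {ι : Matrix (Fin n) (Fin n) D →ₗ[K] R}
  {ι' : Matrix (Fin n') (Fin n') D' →ₗ[K] R}

theorem one_mul_map (h : IsMatrixBlock ι) (M) : ι 1 * ι M = ι M := by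
  rw [← h.map_mul, one_mul]

theorem map_mul_one (h : IsMatrixBlock ι) (M) : ι M * ι 1 = ι M := by
  rw [← h.map_mul, mul_one]

theorem commute (h : IsMatrixBlock ι) (x : R) : ι 1 * x = x * ι 1 := by
  obtain ⟨M, hM⟩ := h.mul_mem_left x 1
  obtain ⟨N, hN⟩ := h.mul_mem_right x 1
  rw [← hN, ← h.map_mul_one, hN, mul_assoc, ← hM, h.one_mul_map]

theorem exists_eq (h : IsMatrixBlock ι) {x : R} (hx : ι 1 * x = x) : ∃ M, ι M = x := by
  obtain ⟨M, hM⟩ := h.mul_mem_right x 1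
  exact ⟨M, hM.trans hx⟩

theorem map_one_ne_zero [NeZero n] (h : IsMatrixBlock ι) : ι 1 ≠ 0 := fun h0 =>
  one_ne_zero (h.injective (h0.trans (map_zero ι).symm))

/-- The identity of a matrix block is a minimal central idempotent. -/
theorem mul_map_one_eq (h : IsMatrixBlock ι) {z : R} (hz : z * z = z)
    (hc : ∀ x, z * x = x * z) : z * ι 1 = 0 ∨ z * ι 1 = ι 1 := by
  obtain ⟨M, hM⟩ := h.mul_mem_left z 1
  rw [← hM]
  have hMM : M * M = M := h.injective (by
    rw [h.map_mul, hM, mul_assoc, ← mul_assoc _ z, ← hc, mul_assoc z, h.one_mul_map,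
      ← mul_assoc, hz])
  have hMc : ∀ w, M * w = w * M := fun w => h.injective (by
    rw [h.map_mul, h.map_mul, hM, mul_assoc, h.one_mul_map, hc, hc, ← mul_assoc,
      h.map_mul_one])
  rcases Matrix.eq_zero_or_one_of_central hMM hMc with rfl | rfl
  · exact Or.inl (map_zero ι)
  · exact Or.inr rfl

/-- Blocks whose identities have a nonzero product have the same identity, by minimality of both
central idempotents. -/
theorem map_one_eq (h : IsMatrixBlock ι) (h' : IsMatrixBlock ι') (hne : ι 1 * ι' 1 ≠ 0) :
    ι 1 = ι' 1 := by
  have e1 := (h'.mul_map_one_eq (h.one_mul_map 1) h.commute).resolve_left hne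
  have e2 := (h.mul_map_one_eq (h'.one_mul_map 1) h'.commute).resolve_left
    (by rwa [h'.commute])
  rw [← e2, h'.commute, e1]

/-- Blocks with the same identity are the same ideal, so the matrix algebras are isomorphic. -/
theorem exists_algEquiv (h : IsMatrixBlock ι) (h' : IsMatrixBlock ι') (he : ι 1 = ι' 1) :
    ∃ F : Matrix (Fin n) (Fin n) D ≃ₐ[K] Matrix (Fin n') (Fin n') D', ∀ M, ι' (F M) = ι M := by
  have hr : LinearMap.range ι = LinearMap.range ι' := by
    ext x
    constructor
    · rintro ⟨M, rfl⟩
      exact h'.exists_eq (by rw [← he, h.one_mul_map])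
    · rintro ⟨M, rfl⟩
      exact h.exists_eq (by rw [he, h'.one_mul_map])
  let F := (LinearEquiv.ofInjective ι h.injective).trans
    ((LinearEquiv.ofEq _ _ hr).trans (LinearEquiv.ofInjective ι' h'.injective).symm)
  have hF : ∀ M, ι' (F M) = ι M := fun M =>
    congrArg Subtype.val ((LinearEquiv.ofInjective ι' h'.injective).apply_symm_apply _)
  exact ⟨AlgEquiv.ofLinearEquiv F (h'.injective (by rw [hF, he]))
    (fun M N => h'.injective (by rw [hF, h'.map_mul, hF, hF, h.map_mul])), hF⟩

end IsMatrixBlock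

/-- A factor of the Wedderburn decomposition is a matrix block. -/
theorem exists_isMatrixBlock (K : Type u) [Field K] (R : Type v) [Ring R] [Algebra K R]
    [IsSemisimpleRing R] [Nontrivial R] :
    ∃ (n : ℕ) (_ : NeZero n) (D : Type v) (_ : DivisionRing D) (_ : Algebra K D)
      (ι : Matrix (Fin n) (Fin n) D →ₗ[K] R), IsMatrixBlock ι := by
  obtain ⟨k, D, d, hD, hA, hd, ⟨F⟩⟩ :=
    IsSemisimpleRing.exists_algEquiv_pi_matrix_divisionRing K R
  have hk : 0 < k := by
    rcases Nat.eq_zero_or_pos k with rfl | hk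
    · exact absurd (F.injective (Subsingleton.elim (F 0) (F 1))) zero_ne_one
    · exact hk
  let i : Fin k := ⟨0, hk⟩
  let ι : Matrix (Fin (d i)) (Fin (d i)) (D i) →ₗ[K] R :=
    F.symm.toLinearMap ∘ₗ LinearMap.single K (fun j => Matrix (Fin (d j)) (Fin (d j)) (D j)) i
  have hι : ∀ M, ι M = F.symm (Pi.single i M) := fun _ => rfl
  refine ⟨d i, hd _, D i, hD _, hA _, ι, ?_, ?_, ?_, ?_⟩
  · intro M N
    rw [hι, hι, hι, ← map_mul, Pi.single_mul]
  · exact F.symm.injective.comp (Pi.single_injective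
      (M := fun j => Matrix (Fin (d j)) (Fin (d j)) (D j)) i)
  · intro x M
    refine ⟨F x i * M, F.injective ?_⟩
    rw [hι, hι, map_mul, AlgEquiv.apply_symm_apply, AlgEquiv.apply_symm_apply]
    funext j
    rcases eq_or_ne j i with rfl | hj
    · simp
    · simp [hj]
  · intro x M
    refine ⟨M * F x i, F.injective ?_⟩
    rw [hι, hι, map_mul, AlgEquiv.apply_symm_apply, AlgEquiv.apply_symm_apply]
    funext j
    rcases eq_or_ne j i with rfl | hj
    · simp
    · simp [hj]

open IsAntiassociativeQuasialgebra (EvenPart)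

/-! ### Matrix blocks of the two models -/

theorem GradedIso.exists_linearEquiv {G K A B : Type*} [Field K] [NonAssocRing A] [Module K A]
    [NonAssocRing B] [Module K B] {𝒜 : G → Submodule K A} {ℬ : G → Submodule K B}
    (h : GradedIso 𝒜 ℬ) :
    ∃ f : A ≃ₗ[K] B, (∀ x y, f (x * y) = f x * f y) ∧ f 1 = 1 ∧ ∀ g x, f x ∈ ℬ g ↔ x ∈ 𝒜 g := by
  obtain ⟨f, hf, hg⟩ := h
  refine ⟨f, hf, ?_, fun g x => ?_⟩
  · have := hf 1 (f.symm 1)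
    rw [one_mul, LinearEquiv.apply_symm_apply, mul_one] at this
    exact this.symm
  · rw [← hg]
    simp

theorem GradedIso.of_linearEquiv {G K A B : Type*} [Field K] [NonAssocRing A] [Module K A]
    [NonAssocRing B] [Module K B] {𝒜 : G → Submodule K A} {ℬ : G → Submodule K B}
    (f : A ≃ₗ[K] B) (hf : ∀ x y, f (x * y) = f x * f y) (h1 : ∀ g, ∀ x ∈ 𝒜 g, f x ∈ ℬ g)
    (h2 : ∀ g, ∀ x ∈ ℬ g, f.symm x ∈ 𝒜 g) : GradedIso 𝒜 ℬ := by
  refine ⟨f, hf, fun g => le_antisymm ?_ fun x hx => ⟨f.symm x, h2 g x hx, by simp⟩⟩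
  rintro _ ⟨x, hx, rfl⟩
  exact h1 g x hx

/-- The inverses of an even unit may be taken even. -/
theorem IsTwoSidedUnit.exists_even {K A : Type*} [Field K] [NonAssocRing A] [Module K A]
    {𝒜 : ZMod 2 → Submodule K A} (h : IsAntiassociativeQuasialgebra 𝒜) {x : A}
    (hx : x ∈ 𝒜 0) (hu : IsTwoSidedUnit x) :
    (∃ l ∈ 𝒜 0, l * x = 1) ∧ ∃ r ∈ 𝒜 0, x * r = 1 := by
  obtain ⟨⟨l, hl⟩, ⟨r, hr⟩⟩ := hu
  obtain ⟨l0, hl0, l1, hl1, rfl⟩ := h.exists_add l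
  obtain ⟨r0, hr0, r1, hr1, rfl⟩ := h.exists_add r
  rw [add_mul] at hl
  rw [mul_add] at hr
  rw [← add_zero (1 : A)] at hl hr
  exact ⟨⟨l0, hl0, (h.eq_of_add_eq (h.even_mul_even hl0 hx) h.one_mem (h.odd_mul_even hl1 hx)
      (𝒜 1).zero_mem hl).1⟩,
    ⟨r0, hr0, (h.eq_of_add_eq (h.even_mul_even hx hr0) h.one_mem (h.even_mul_odd hx hr1)
      (𝒜 1).zero_mem hr).1⟩⟩

/-- The inverses of an odd unit may be taken odd. -/
theorem IsTwoSidedUnit.exists_odd {K A : Type*} [Field K] [NonAssocRing A] [Module K A]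
    {𝒜 : ZMod 2 → Submodule K A} (h : IsAntiassociativeQuasialgebra 𝒜) {x : A}
    (hx : x ∈ 𝒜 1) (hu : IsTwoSidedUnit x) :
    (∃ l ∈ 𝒜 1, l * x = 1) ∧ ∃ r ∈ 𝒜 1, x * r = 1 := by
  obtain ⟨⟨l, hl⟩, ⟨r, hr⟩⟩ := hu
  obtain ⟨l0, hl0, l1, hl1, rfl⟩ := h.exists_add l
  obtain ⟨r0, hr0, r1, hr1, rfl⟩ := h.exists_add r
  rw [add_mul, add_comm] at hl
  rw [mul_add, add_comm] at hr
  rw [← add_zero (1 : A)] at hl hr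
  exact ⟨⟨l1, hl1, (h.eq_of_add_eq (h.odd_mul_odd hl1 hx) h.one_mem (h.even_mul_odd hl0 hx)
      (𝒜 1).zero_mem hl).1⟩,
    ⟨r1, hr1, (h.eq_of_add_eq (h.odd_mul_odd hx hr1) h.one_mem (h.odd_mul_even hx hr0)
      (𝒜 1).zero_mem hr).1⟩⟩

/-- The even part of a division antiassociative quasialgebra is a division ring. -/
noncomputable abbrev IsDivisionAntiassociative.divisionRing {K Δ : Type*} [Field K]
    [NonAssocRing Δ] [Module K Δ] {𝒟 : ZMod 2 → Submodule K Δ}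
    (h : IsDivisionAntiassociative 𝒟) : DivisionRing h.antiassociative.EvenPart :=
  have : Nontrivial h.antiassociative.EvenPart := by
    have := h.nontrivial
    exact ⟨0, 1, fun h0 => zero_ne_one (α := Δ) (congrArg (EvenPart.val _) h0)⟩
  DivisionRing.ofIsUnitOrEqZero fun a => by
    by_cases ha : a = 0
    · exact Or.inr ha
    · left
      obtain ⟨⟨l, hl, hla⟩, ⟨r, hr, har⟩⟩ := IsTwoSidedUnit.exists_even h.antiassociative
        (EvenPart.val_mem a) (h.isUnit 0 _ (EvenPart.val_mem a)
          (fun h0 => ha (EvenPart.val_injective (h0.trans (map_zero _).symm))))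
      exact isUnit_iff_exists.2 ⟨EvenPart.mk _ r hr, EvenPart.val_injective har, by
        have : EvenPart.mk h.antiassociative l hl = EvenPart.mk _ r hr :=
          left_inv_eq_right_inv (a := a) (EvenPart.val_injective hla) (EvenPart.val_injective har)
        rw [← this]
        exact EvenPart.val_injective hla⟩

section Models

variable {K : Type u} [Field K] {A : Type v} [NonAssocRing A] [Module K A]
  {𝒜 : ZMod 2 → Submodule K A}

/-- An odd unit forces the two diagonal blocks of a chess-board algebra to have the same size:
a left inverse of the unit gives rectangular matrices of both shapes with product `1`. -/
theorem eq_of_gradedIso_chess (hcross : IsQuasicrossedProduct 𝒜) {n m : ℕ} {D : Type v}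
    [DivisionRing D] [Algebra K D] (hf : GradedIso 𝒜 (ChessMat.grading K n m D)) : n = m := by
  obtain ⟨f, hmul, hone, hmem⟩ := hf.exists_linearEquiv
  obtain ⟨x, hx, ⟨l, hl⟩, -⟩ := hcross 1
  have hx' := (hmem 1 x).2 hx
  obtain ⟨ha, hb⟩ : (f x).a = 0 ∧ (f x).b = 0 := hx'
  have hl' : f l * f x = 1 := by rw [← hmul, hl, hone]
  have h1 := congrArg ChessMat.a hl'
  have h2 := congrArg ChessMat.b hl'
  simp only [ChessMat.mul_def, ChessMat.one_def, ha, hb, Matrix.mul_zero, zero_add,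
    add_zero] at h1 h2
  rw [← Matrix.neg_mul] at h2
  exact le_antisymm (rankCondition_iff_matrix.1 (inferInstance : RankCondition D) _ _ _ _ h1)
    (rankCondition_iff_matrix.1 (inferInstance : RankCondition D) _ _ _ _ h2)

theorem ne_zero_of_gradedIso_matrix [Nontrivial A] {n : ℕ} {Δ : Type v} [NonAssocRing Δ]
    [Module K Δ] {𝒟 : ZMod 2 → Submodule K Δ} (hf : GradedIso 𝒜 (matrixGrading n 𝒟)) :
    NeZero n := by
  obtain ⟨f, -⟩ := hf
  refine ⟨?_⟩
  rintro rfl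
  exact not_subsingleton A (f.injective.subsingleton)

theorem ne_zero_of_gradedIso_chess [Nontrivial A] (hcross : IsQuasicrossedProduct 𝒜) {n m : ℕ}
    {D : Type v} [DivisionRing D] [Algebra K D]
    (hf : GradedIso 𝒜 (ChessMat.grading K n m D)) : NeZero n ∧ NeZero m := by
  obtain rfl := eq_of_gradedIso_chess hcross hf
  obtain ⟨f, -⟩ := hf
  rw [and_self]
  refine ⟨?_⟩
  rintro rfl
  have : Subsingleton (ChessMat 0 0 D) := ChessMat.equivProd.injective.subsingleton
  exact not_subsingleton A (f.injective.subsingleton)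

variable [IsScalarTower K A A] [SMulCommClass K A A]

/-- In an algebra isomorphic to `Mat_n(Δ)`, the even part is a single matrix block, and `Δ` is
the corner of the algebra at the first diagonal matrix unit of this block. -/
theorem exists_isMatrixBlock_of_gradedIso_matrix (hA : IsAntiassociativeQuasialgebra 𝒜)
    {n : ℕ} [NeZero n] {Δ : Type v} [NonAssocRing Δ] [Module K Δ] [IsScalarTower K Δ Δ]
    [SMulCommClass K Δ Δ] {𝒟 : ZMod 2 → Submodule K Δ} (hD : IsDivisionAntiassociative 𝒟)
    (hf : GradedIso 𝒜 (matrixGrading n 𝒟)) :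
    ∃ (D : Type v) (_ : DivisionRing D) (_ : Algebra K D)
      (ι : Matrix (Fin n) (Fin n) D →ₗ[K] hA.EvenPart) (κ : Δ →ₗ[K] A),
      IsMatrixBlock ι ∧ ι 1 = 1 ∧ IsCornerMap κ ∧ (∀ g d, κ d ∈ 𝒜 g ↔ d ∈ 𝒟 g) ∧
      EvenPart.val hA (ι (Matrix.single 0 0 1)) = κ 1 := by
  obtain ⟨f, hmul, hone, hmem⟩ := hf.exists_linearEquiv
  have hmul' : ∀ x y, f.symm (x * y) = f.symm x * f.symm y := fun x y =>
    f.injective (by simp [hmul])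
  let := hD.divisionRing
  let B := hD.antiassociative.EvenPart
  let j : Matrix (Fin n) (Fin n) B →ₗ[K] A :=
    f.symm.toLinearMap ∘ₗ (EvenPart.val hD.antiassociative).mapMatrix
  have hj : ∀ M, j M = f.symm (M.map (EvenPart.val hD.antiassociative)) := fun _ => rfl
  have hj0 : ∀ M, j M ∈ 𝒜 0 := fun M => by
    rw [← hmem, hj, LinearEquiv.apply_symm_apply]
    exact fun _ _ => EvenPart.val_mem _
  let ι : Matrix (Fin n) (Fin n) B →ₗ[K] hA.EvenPart := j.codRestrict (𝒜 0) hj0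
  have hι : ∀ M, EvenPart.val hA (ι M) = f.symm (M.map (EvenPart.val hD.antiassociative)) :=
    fun _ => rfl
  have hιsurj : ∀ x, ∃ M, ι M = x := fun x => by
    have hx : f (EvenPart.val hA x) ∈ matrixGrading n 𝒟 0 := (hmem _ _).2 (EvenPart.val_mem x)
    refine ⟨Matrix.of fun i k => EvenPart.mk hD.antiassociative _ (hx i k),
      EvenPart.val_injective (f.injective ?_)⟩
    rw [hι, LinearEquiv.apply_symm_apply]
    rfl
  let κ : Δ →ₗ[K] A := f.symm.toLinearMap ∘ₗ Matrix.singleLinearMap K 0 0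
  have hκ : ∀ d, κ d = f.symm (Matrix.single 0 0 d) := fun _ => rfl
  have hS := isCornerMap_single K (n := n) (B := Δ) 0
  refine ⟨B, inferInstance, inferInstance, ι, κ, ⟨?_, ?_, fun _ _ => hιsurj _,
    fun _ _ => hιsurj _⟩, ?_, ⟨?_, f.symm.injective.comp hS.injective, ?_⟩, ?_, ?_⟩
  · intro M N
    apply EvenPart.val_injective
    rw [EvenPart.val_mul, hι, hι, hι, ← hmul']
    congr 1
    ext i k
    simp only [Matrix.map_apply, Matrix.mul_apply, map_sum]
    exact Finset.sum_congr rfl fun _ _ => rfl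
  · intro M N hMN
    have := f.symm.injective ((hι M).symm.trans ((congrArg _ hMN).trans (hι N)))
    ext i k
    exact EvenPart.val_injective (congr_fun (congr_fun this i) k)
  · apply EvenPart.val_injective
    rw [hι, EvenPart.val_one, LinearEquiv.symm_apply_eq, hone]
    ext i k
    by_cases hik : i = k <;> simp [Matrix.one_apply, hik]
  · intro a b
    rw [hκ, hκ, hκ, ← hmul']
    exact congrArg _ (hS.map_mul a b)
  · intro a h1 h2
    rw [hκ] at h1 h2
    obtain ⟨b, hb⟩ := hS.exists_eq (f a) (by
        have := congrArg f h1
        rwa [hmul, LinearEquiv.apply_symm_apply] at this) (by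
        have := congrArg f h2
        rwa [hmul, LinearEquiv.apply_symm_apply] at this)
    exact ⟨b, f.injective ((f.apply_symm_apply _).trans hb)⟩
  · intro g d
    rw [← hmem, hκ, LinearEquiv.apply_symm_apply]
    constructor
    · intro h0
      simpa using h0 0 0
    · intro hd i k
      rw [Matrix.single_apply]
      split_ifs
      exacts [hd, (𝒟 g).zero_mem]
  · rw [hι, hκ]
    congr 1
    ext i k
    rw [Matrix.map_apply, Matrix.single_apply, Matrix.single_apply]
    split_ifs
    exacts [EvenPart.val_one _, map_zero _]

/-- In an algebra isomorphic to a chess-board algebra, the two diagonal blocks are matrix blocks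
of the even part, with complementary identities. -/
theorem exists_isMatrixBlock_of_gradedIso_chess (hA : IsAntiassociativeQuasialgebra 𝒜)
    {n m : ℕ} {D : Type v} [DivisionRing D] [Algebra K D]
    (hf : GradedIso 𝒜 (ChessMat.grading K n m D)) :
    ∃ (ι₁ : Matrix (Fin n) (Fin n) D →ₗ[K] hA.EvenPart)
      (ι₂ : Matrix (Fin m) (Fin m) D →ₗ[K] hA.EvenPart),
      IsMatrixBlock ι₁ ∧ IsMatrixBlock ι₂ ∧ ι₁ 1 + ι₂ 1 = 1 ∧ ι₁ 1 * ι₂ 1 = 0 := by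
  obtain ⟨f, hmul, hone, hmem⟩ := hf.exists_linearEquiv
  have hmul' : ∀ x y, f.symm (x * y) = f.symm x * f.symm y := fun x y =>
    f.injective (by simp [hmul])
  have mem0 : ∀ x : ChessMat n m D, x ∈ ChessMat.grading K n m D 0 ↔ x.v = 0 ∧ x.w = 0 :=
    fun x => Iff.rfl
  let c₁ : Matrix (Fin n) (Fin n) D →ₗ[K] ChessMat n m D :=
    { toFun := fun M => ⟨M, 0, 0, 0⟩
      map_add' := fun M N => by simp [ChessMat.add_def]
      map_smul' := fun c M => by simp [ChessMat.smul_def] }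
  let c₂ : Matrix (Fin m) (Fin m) D →ₗ[K] ChessMat n m D :=
    { toFun := fun M => ⟨0, 0, 0, M⟩
      map_add' := fun M N => by simp [ChessMat.add_def]
      map_smul' := fun c M => by simp [ChessMat.smul_def] }
  have hc₁ : ∀ M, f.symm (c₁ M) ∈ 𝒜 0 := fun M => by
    rw [← hmem, LinearEquiv.apply_symm_apply]; exact ⟨rfl, rfl⟩
  have hc₂ : ∀ M, f.symm (c₂ M) ∈ 𝒜 0 := fun M => by
    rw [← hmem, LinearEquiv.apply_symm_apply]; exact ⟨rfl, rfl⟩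
  let ι₁ : Matrix (Fin n) (Fin n) D →ₗ[K] hA.EvenPart :=
    (f.symm.toLinearMap ∘ₗ c₁).codRestrict (𝒜 0) hc₁
  let ι₂ : Matrix (Fin m) (Fin m) D →ₗ[K] hA.EvenPart :=
    (f.symm.toLinearMap ∘ₗ c₂).codRestrict (𝒜 0) hc₂
  have hι₁ : ∀ M, EvenPart.val hA (ι₁ M) = f.symm ⟨M, 0, 0, 0⟩ := fun _ => rfl
  have hι₂ : ∀ M, EvenPart.val hA (ι₂ M) = f.symm ⟨0, 0, 0, M⟩ := fun _ => rfl
  -- every even element is `f.symm` of a block diagonal matrix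
  have hev : ∀ x : hA.EvenPart, ∃ a b, EvenPart.val hA x = f.symm ⟨a, 0, 0, b⟩ := fun x => by
    have := (hmem 0 _).2 (EvenPart.val_mem x)
    obtain ⟨hv, hw⟩ := (mem0 _).1 this
    refine ⟨(f (EvenPart.val hA x)).a, (f (EvenPart.val hA x)).b, ?_⟩
    rw [LinearEquiv.eq_symm_apply]
    ext1
    exacts [rfl, hv, hw, rfl]
  refine ⟨ι₁, ι₂, ⟨?_, ?_, ?_, ?_⟩, ⟨?_, ?_, ?_, ?_⟩, ?_, ?_⟩
  · intro M N
    apply EvenPart.val_injective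
    rw [EvenPart.val_mul, hι₁, hι₁, hι₁, ← hmul', ChessMat.mul_def]
    simp
  · intro M N hMN
    have := f.symm.injective ((hι₁ M).symm.trans ((congrArg _ hMN).trans (hι₁ N)))
    exact congrArg ChessMat.a this
  · intro x M
    obtain ⟨a, b, hx⟩ := hev x
    refine ⟨a * M, EvenPart.val_injective ?_⟩
    rw [EvenPart.val_mul, hι₁, hι₁, hx, ← hmul', ChessMat.mul_def]
    simp
  · intro x M
    obtain ⟨a, b, hx⟩ := hev x
    refine ⟨M * a, EvenPart.val_injective ?_⟩
    rw [EvenPart.val_mul, hι₁, hι₁, hx, ← hmul', ChessMat.mul_def]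
    simp
  · intro M N
    apply EvenPart.val_injective
    rw [EvenPart.val_mul, hι₂, hι₂, hι₂, ← hmul', ChessMat.mul_def]
    simp
  · intro M N hMN
    have := f.symm.injective ((hι₂ M).symm.trans ((congrArg _ hMN).trans (hι₂ N)))
    exact congrArg ChessMat.b this
  · intro x M
    obtain ⟨a, b, hx⟩ := hev x
    refine ⟨b * M, EvenPart.val_injective ?_⟩
    rw [EvenPart.val_mul, hι₂, hι₂, hx, ← hmul', ChessMat.mul_def]
    simp
  · intro x M
    obtain ⟨a, b, hx⟩ := hev x
    refine ⟨M * b, EvenPart.val_injective ?_⟩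
    rw [EvenPart.val_mul, hι₂, hι₂, hx, ← hmul', ChessMat.mul_def]
    simp
  · apply EvenPart.val_injective
    rw [map_add, hι₁, hι₂, ← map_add, EvenPart.val_one, LinearEquiv.symm_apply_eq, hone,
      ChessMat.add_def, ChessMat.one_def]
    simp
  · apply EvenPart.val_injective
    rw [EvenPart.val_mul, hι₁, hι₂, ← hmul', ChessMat.mul_def, map_zero]
    simp

/-! ### Uniqueness -/

/-- The even part of `Mat_n(Δ)` has no central idempotents other than `0` and `1`, in contrast to
that of a chess-board algebra. -/
theorem not_gradedIso_chess_of_gradedIso_matrix [Nontrivial A]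
    (hA : IsAntiassociativeQuasialgebra 𝒜) (hcross : IsQuasicrossedProduct 𝒜)
    {n : ℕ} {Δ : Type v} [NonAssocRing Δ] [Module K Δ] [IsScalarTower K Δ Δ]
    [SMulCommClass K Δ Δ] {𝒟 : ZMod 2 → Submodule K Δ} (hD : IsDivisionAntiassociative 𝒟)
    (hf : GradedIso 𝒜 (matrixGrading n 𝒟)) {p q : ℕ} {D : Type v} [DivisionRing D] [Algebra K D] :
    ¬ GradedIso 𝒜 (ChessMat.grading K p q D) := by
  intro hf'
  have := ne_zero_of_gradedIso_matrix hf
  obtain ⟨_, _⟩ := ne_zero_of_gradedIso_chess hcross hf'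
  obtain ⟨D', _, _, ι, -, hι, hone, -⟩ := exists_isMatrixBlock_of_gradedIso_matrix hA hD hf
  obtain ⟨ι₁, ι₂, h₁, h₂, -, hmul⟩ := exists_isMatrixBlock_of_gradedIso_chess hA hf'
  have := hι.mul_map_one_eq (h₁.one_mul_map 1) h₁.commute
  rw [hone, mul_one] at this
  rcases this with h0 | h0
  · exact h₁.map_one_ne_zero h0
  · rw [h0, one_mul] at hmul
    exact h₂.map_one_ne_zero hmul

theorem eq_and_gradedIso_of_gradedIso_matrix [Nontrivial A]
    (hA : IsAntiassociativeQuasialgebra 𝒜) {n n' : ℕ}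
    {Δ : Type v} [NonAssocRing Δ] [Module K Δ] [IsScalarTower K Δ Δ]
    [SMulCommClass K Δ Δ] {𝒟 : ZMod 2 → Submodule K Δ}
    {Δ' : Type v} [NonAssocRing Δ'] [Module K Δ'] [IsScalarTower K Δ' Δ']
    [SMulCommClass K Δ' Δ'] {𝒟' : ZMod 2 → Submodule K Δ'}
    (hD : IsDivisionAntiassociative 𝒟) (hD' : IsDivisionAntiassociative 𝒟')
    (hf : GradedIso 𝒜 (matrixGrading n 𝒟)) (hf' : GradedIso 𝒜 (matrixGrading n' 𝒟')) :
    n = n' ∧ GradedIso 𝒟 𝒟' := by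
  have := ne_zero_of_gradedIso_matrix hf
  have := ne_zero_of_gradedIso_matrix hf'
  obtain ⟨D, _, _, ι, κ, hι, hone, hκ, hmem, hκ1⟩ :=
    exists_isMatrixBlock_of_gradedIso_matrix hA hD hf
  obtain ⟨D', _, _, ι', κ', hι', hone', hκ', hmem', hκ1'⟩ :=
    exists_isMatrixBlock_of_gradedIso_matrix hA hD' hf'
  obtain ⟨F, hF⟩ := hι.exists_algEquiv hι' (hone.trans hone'.symm)
  refine ⟨Matrix.eq_of_ringEquiv F.toRingEquiv, ?_⟩
  obtain ⟨x, y, hxy, hyx⟩ := Matrix.exists_mul_eq_single F.toRingEquiv 0 0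
  have hx := EvenPart.val_mem (ι' x)
  have hy := EvenPart.val_mem (ι' y)
  have hxy' : EvenPart.val hA (ι' x) * EvenPart.val hA (ι' y) = κ 1 := by
    rw [← EvenPart.val_mul, ← hι'.map_mul, hxy, ← hκ1]
    exact congrArg _ (hF _)
  have hyx' : EvenPart.val hA (ι' y) * EvenPart.val hA (ι' x) = κ' 1 := by
    rw [← EvenPart.val_mul, ← hι'.map_mul, hyx, hκ1']
  obtain ⟨f, hfmul, hf1, hf2⟩ :=
    hκ.exists_linearEquiv hκ' (hA.isNuclear hx) (hA.isNuclear hy) hxy' hyx'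
  have conj_mem : ∀ g, ∀ a ∈ 𝒜 g, ∀ s ∈ 𝒜 0, ∀ t ∈ 𝒜 0, s * (a * t) ∈ 𝒜 g := by
    intro g a ha s hs t ht
    have := hA.mul_mem 0 _ s hs _ (hA.mul_mem g 0 a ha t ht)
    rwa [zero_add, add_zero] at this
  refine GradedIso.of_linearEquiv f hfmul (fun g d hd => ?_) (fun g d hd => ?_)
  · rw [← hmem', hf1]
    exact conj_mem g _ ((hmem g d).2 hd) _ hy _ hx
  · rw [← hmem, hf2]
    exact conj_mem g _ ((hmem' g d).2 hd) _ hx _ hy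

theorem eq_and_nonempty_algEquiv_of_gradedIso_chess [Nontrivial A]
    (hA : IsAntiassociativeQuasialgebra 𝒜) (hcross : IsQuasicrossedProduct 𝒜) {n m n' m' : ℕ}
    {D : Type v} [DivisionRing D] [Algebra K D] {D' : Type v} [DivisionRing D'] [Algebra K D']
    (hf : GradedIso 𝒜 (ChessMat.grading K n m D))
    (hf' : GradedIso 𝒜 (ChessMat.grading K n' m' D')) :
    n = n' ∧ m = m' ∧ Nonempty (D ≃ₐ[K] D') := by
  obtain rfl := eq_of_gradedIso_chess hcross hf
  obtain rfl := eq_of_gradedIso_chess hcross hf'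
  obtain ⟨_, -⟩ := ne_zero_of_gradedIso_chess hcross hf
  obtain ⟨_, -⟩ := ne_zero_of_gradedIso_chess hcross hf'
  obtain ⟨ι, -, hι, -⟩ := exists_isMatrixBlock_of_gradedIso_chess hA hf
  obtain ⟨ι₁, ι₂, h₁, h₂, hadd, -⟩ := exists_isMatrixBlock_of_gradedIso_chess hA hf'
  -- the first block on the left is one of the two blocks on the right
  obtain ⟨ι', hι', hne⟩ : ∃ ι' : Matrix (Fin n') (Fin n') D' →ₗ[K] hA.EvenPart,
      IsMatrixBlock ι' ∧ ι 1 * ι' 1 ≠ 0 := by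
    by_contra! hc
    apply hι.map_one_ne_zero
    rw [← mul_one (ι 1), ← hadd, mul_add, hc ι₁ h₁, hc ι₂ h₂, add_zero]
  obtain ⟨F, -⟩ := hι.exists_algEquiv hι' (hι.map_one_eq hι' hne)
  have := Matrix.eq_of_ringEquiv F.toRingEquiv
  exact ⟨this, this, Matrix.nonempty_algEquiv_of_algEquiv F⟩

end Models

/-! ### Odd units and the induced automorphism of the even part -/

section OddUnit

variable {K : Type u} [Field K] {A : Type v} [NonAssocRing A] [Module K A]
  {𝒜 : ZMod 2 → Submodule K A}

/-- `u` is an odd element with right inverse `r`. By antiassociativity `-r` is then the left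
inverse of `u`. -/
structure IsOddUnit (𝒜 : ZMod 2 → Submodule K A) (u r : A) : Prop where
  mem : u ∈ 𝒜 1
  inv_mem : r ∈ 𝒜 1
  mul_inv : u * r = 1
  inv_mul : r * u = -1

theorem exists_isOddUnit (hA : IsAntiassociativeQuasialgebra 𝒜)
    (hcross : IsQuasicrossedProduct 𝒜) : ∃ u r, IsOddUnit 𝒜 u r := by
  obtain ⟨u, hu, h⟩ := hcross 1
  obtain ⟨⟨l, hl, hlu⟩, ⟨r, hr, hur⟩⟩ := IsTwoSidedUnit.exists_odd hA hu h
  have hrl : r = -l := by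
    have := hA.odd_assoc hl hu hr
    rw [hlu, hur, one_mul, mul_one] at this
    exact this
  exact ⟨u, r, hu, hr, hur, by rw [hrl, neg_mul, hlu]⟩

namespace IsOddUnit

variable {u r : A}

theorem mul_inv_mul (h : IsOddUnit 𝒜 u r) (hA : IsAntiassociativeQuasialgebra 𝒜)
    {x : A} (hx : x ∈ 𝒜 1) : (x * r) * u = x := by
  rw [hA.odd_assoc hx h.inv_mem h.mem, h.inv_mul, mul_neg, mul_one, neg_neg]

theorem mul_mul_inv (h : IsOddUnit 𝒜 u r) (hA : IsAntiassociativeQuasialgebra 𝒜)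
    {x : A} (hx : x ∈ 𝒜 1) : (x * u) * r = -x := by
  rw [hA.odd_assoc hx h.mem h.inv_mem, h.mul_inv, mul_one]

theorem inv_mul_mul (h : IsOddUnit 𝒜 u r) (hA : IsAntiassociativeQuasialgebra 𝒜)
    {x : A} (hx : x ∈ 𝒜 1) : r * (u * x) = x := by
  have := hA.odd_assoc h.inv_mem h.mem hx
  rw [h.inv_mul, neg_one_mul] at this
  exact (neg_injective this).symm

theorem even_mul_mul_inv (h : IsOddUnit 𝒜 u r) (hA : IsAntiassociativeQuasialgebra 𝒜)
    {x : A} (hx : x ∈ 𝒜 0) : (x * u) * r = x := by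
  rw [(hA.isNuclear hx).left, h.mul_inv, mul_one]

theorem mul_right_cancel (h : IsOddUnit 𝒜 u r) (hA : IsAntiassociativeQuasialgebra 𝒜)
    {a b : hA.EvenPart} (hab : EvenPart.val hA a * u = EvenPart.val hA b * u) : a = b := by
  apply EvenPart.val_injective
  rw [← h.even_mul_mul_inv hA (EvenPart.val_mem a), hab,
    h.even_mul_mul_inv hA (EvenPart.val_mem b)]

/-- The even element `(u * a) * r`, the conjugate of `a` by the odd unit `u`. -/
def conj (h : IsOddUnit 𝒜 u r) (hA : IsAntiassociativeQuasialgebra 𝒜)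
    (a : hA.EvenPart) : hA.EvenPart :=
  EvenPart.mk hA ((u * EvenPart.val hA a) * r)
    (hA.odd_mul_odd (hA.odd_mul_even h.mem (EvenPart.val_mem a)) h.inv_mem)

theorem conj_mul (h : IsOddUnit 𝒜 u r) (hA : IsAntiassociativeQuasialgebra 𝒜)
    (a : hA.EvenPart) : EvenPart.val hA (h.conj hA a) * u = u * EvenPart.val hA a :=
  h.mul_inv_mul hA (hA.odd_mul_even h.mem (EvenPart.val_mem a))

/-- The automorphism `σ` of the even part determined by `σ(a) u = u a`. -/
def twist (h : IsOddUnit 𝒜 u r) (hA : IsAntiassociativeQuasialgebra 𝒜) :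
    hA.EvenPart →+* hA.EvenPart where
  toFun := h.conj hA
  map_one' := EvenPart.val_injective (by simp [conj, h.mul_inv])
  map_zero' := EvenPart.val_injective (by simp [conj])
  map_add' := fun a b => EvenPart.val_injective (by simp [conj, mul_add, add_mul])
  map_mul' := fun a b => h.mul_right_cancel hA (by
    rw [conj_mul, EvenPart.val_mul, EvenPart.val_mul, ← (hA.isNuclear (EvenPart.val_mem a)).mid,
      ← h.conj_mul hA a, (hA.isNuclear (EvenPart.val_mem b)).right, ← h.conj_mul hA b,
      (hA.isNuclear (EvenPart.val_mem _)).left])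

theorem twist_mul (h : IsOddUnit 𝒜 u r) (hA : IsAntiassociativeQuasialgebra 𝒜)
    (a : hA.EvenPart) : EvenPart.val hA (h.twist hA a) * u = u * EvenPart.val hA a :=
  h.conj_mul hA a

theorem twist_surjective (h : IsOddUnit 𝒜 u r) (hA : IsAntiassociativeQuasialgebra 𝒜) :
    Function.Surjective (h.twist hA) := fun b => by
  have hbu := hA.even_mul_odd (EvenPart.val_mem b) h.mem
  refine ⟨EvenPart.mk hA (-(r * (EvenPart.val hA b * u)))
    ((𝒜 0).neg_mem (hA.odd_mul_odd h.inv_mem hbu)), h.mul_right_cancel hA ?_⟩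
  rw [h.twist_mul hA, EvenPart.val_mk, mul_neg, ← hA.odd_assoc h.mem h.inv_mem hbu, h.mul_inv,
    one_mul]

/-- Every element is `c + d * u` with `c`, `d` even. -/
theorem exists_add_mul (h : IsOddUnit 𝒜 u r) (hA : IsAntiassociativeQuasialgebra 𝒜)
    (x : A) : ∃ c d, EvenPart.val hA c + EvenPart.val hA d * u = x := by
  obtain ⟨a, ha, b, hb, rfl⟩ := hA.exists_add x
  exact ⟨EvenPart.mk hA a ha, EvenPart.mk hA (b * r) (hA.odd_mul_odd hb h.inv_mem),
    by rw [EvenPart.val_mk, EvenPart.val_mk, h.mul_inv_mul hA hb]⟩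

/-- The square of the odd unit, as an element of the even part. -/
def sq (h : IsOddUnit 𝒜 u r) (hA : IsAntiassociativeQuasialgebra 𝒜) :
    hA.EvenPart := EvenPart.mk hA (u * u) (hA.odd_mul_odd h.mem h.mem)

/-- The product of `A` in terms of the even part, the twist, and the square of the odd unit. -/
theorem add_mul_mul_add_mul (h : IsOddUnit 𝒜 u r) (hA : IsAntiassociativeQuasialgebra 𝒜)
    (c d a b : hA.EvenPart) :
    (EvenPart.val hA c + EvenPart.val hA d * u) * (EvenPart.val hA a + EvenPart.val hA b * u) =
      EvenPart.val hA (c * a + d * h.twist hA b * h.sq hA) +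
        EvenPart.val hA (c * b + d * h.twist hA a) * u := by
  have e1 : EvenPart.val hA d * u * EvenPart.val hA a =
      EvenPart.val hA d * EvenPart.val hA (h.twist hA a) * u := by
    rw [(hA.isNuclear (EvenPart.val_mem d)).left, ← h.twist_mul hA,
      (hA.isNuclear (EvenPart.val_mem d)).left]
  have e2 : EvenPart.val hA d * u * (EvenPart.val hA b * u) =
      EvenPart.val hA d * EvenPart.val hA (h.twist hA b) * (u * u) := by
    rw [(hA.isNuclear (EvenPart.val_mem d)).left, ← (hA.isNuclear (EvenPart.val_mem b)).mid,
      ← h.twist_mul hA, (hA.isNuclear (EvenPart.val_mem _)).left,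
      (hA.isNuclear (EvenPart.val_mem d)).left]
  have e3 : EvenPart.val hA c * (EvenPart.val hA b * u) =
      EvenPart.val hA c * EvenPart.val hA b * u :=
    ((hA.isNuclear (EvenPart.val_mem c)).left _ _).symm
  simp only [add_mul, mul_add, map_add, EvenPart.val_mul, e1, e2, e3, sq, EvenPart.val_mk]
  abel

/-- The square of the twist is conjugation by `u * u`, so it fixes central elements. -/
theorem twist_twist (h : IsOddUnit 𝒜 u r) (hA : IsAntiassociativeQuasialgebra 𝒜)
    {z : hA.EvenPart} (hz : ∀ x, z * x = x * z) :
    h.twist hA (h.twist hA z) = z := by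
  have hu := h.mem
  have e1 : EvenPart.val hA (h.twist hA (h.twist hA z)) * (u * u) =
      (u * u) * EvenPart.val hA z := by
    rw [← (hA.isNuclear (EvenPart.val_mem _)).left, h.twist_mul hA,
      (hA.isNuclear (EvenPart.val_mem _)).mid, h.twist_mul hA,
      (hA.isNuclear (EvenPart.val_mem _)).right]
  have e2 : (u * u) * EvenPart.val hA z = EvenPart.val hA z * (u * u) :=
    congrArg (EvenPart.val hA) (hz (h.sq hA)).symm
  rw [e2, ← (hA.isNuclear (EvenPart.val_mem _)).left, ← (hA.isNuclear (EvenPart.val_mem _)).left]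
    at e1
  have e3 := congrArg (· * r) e1
  simp only [h.mul_mul_inv hA (hA.even_mul_odd (EvenPart.val_mem _) hu)] at e3
  exact h.mul_right_cancel hA (neg_injective e3)

/-- Graded simplicity of `A` says that the even part has no twist-stable proper ideals:
such an ideal `J` gives the graded ideal `J + J * u`. -/
theorem eq_bot_or_one_mem [IsScalarTower K A A] [SMulCommClass K A A]
    (h : IsOddUnit 𝒜 u r) (hA : IsAntiassociativeQuasialgebra 𝒜)
    (hsimple : IsGradedSimple 𝒜) (J : Submodule K hA.EvenPart)
    (hl : ∀ x, ∀ a ∈ J, x * a ∈ J) (hr : ∀ x, ∀ a ∈ J, a * x ∈ J)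
    (ht : ∀ a ∈ J, h.twist hA a ∈ J) : J = ⊥ ∨ 1 ∈ J := by
  let I : Submodule K A :=
    { carrier := {z | ∃ a ∈ J, ∃ b ∈ J, EvenPart.val hA a + EvenPart.val hA b * u = z}
      add_mem' := by
        rintro _ _ ⟨a, ha, b, hb, rfl⟩ ⟨a', ha', b', hb', rfl⟩
        refine ⟨a + a', J.add_mem ha ha', b + b', J.add_mem hb hb', ?_⟩
        simp only [map_add, add_mul]
        abel
      zero_mem' := ⟨0, J.zero_mem, 0, J.zero_mem, by simp⟩
      smul_mem' := by
        rintro c _ ⟨a, ha, b, hb, rfl⟩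
        exact ⟨c • a, J.smul_mem c ha, c • b, J.smul_mem c hb, by
          simp only [map_smul, smul_add, smul_mul_assoc]⟩ }
  have hI0 : ∀ a ∈ J, EvenPart.val hA a ∈ I := fun a ha => ⟨a, ha, 0, J.zero_mem, by simp⟩
  have hI1 : ∀ a ∈ J, EvenPart.val hA a * u ∈ I := fun a ha => ⟨0, J.zero_mem, a, ha, by simp⟩
  have hI : IsGradedIdeal 𝒜 I := by
    refine ⟨le_antisymm ?_ (iSup_le fun g => inf_le_left), ?_, ?_⟩
    · rintro _ ⟨a, ha, b, hb, rfl⟩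
      exact Submodule.add_mem _
        (Submodule.mem_iSup_of_mem 0 ⟨hI0 a ha, EvenPart.val_mem a⟩)
        (Submodule.mem_iSup_of_mem 1 ⟨hI1 b hb, hA.even_mul_odd (EvenPart.val_mem b) h.mem⟩)
    · rintro x _ ⟨a, ha, b, hb, rfl⟩
      obtain ⟨c, d, rfl⟩ := h.exists_add_mul hA x
      rw [h.add_mul_mul_add_mul hA]
      exact ⟨_, J.add_mem (hl _ _ ha) (hr _ _ (hl _ _ (ht _ hb))), _,
        J.add_mem (hl _ _ hb) (hl _ _ (ht _ ha)), rfl⟩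
    · rintro x _ ⟨a, ha, b, hb, rfl⟩
      obtain ⟨c, d, rfl⟩ := h.exists_add_mul hA x
      rw [h.add_mul_mul_add_mul hA]
      exact ⟨_, J.add_mem (hr _ _ ha) (hr _ _ (hr _ _ hb)), _,
        J.add_mem (hr _ _ ha) (hr _ _ hb), rfl⟩
  rcases hsimple.eq_bot_or_eq_top I hI with h0 | h1
  · left
    rw [eq_bot_iff]
    intro a ha
    have := hI0 a ha
    rw [h0, Submodule.mem_bot] at this
    exact EvenPart.val_injective (this.trans (map_zero _).symm)
  · right
    have : (1 : A) ∈ I := h1 ▸ Submodule.mem_top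
    obtain ⟨a, ha, b, hb, hab⟩ := this
    have := (hA.eq_of_add_eq (EvenPart.val_mem a) hA.one_mem
      (hA.even_mul_odd (EvenPart.val_mem b) h.mem) (𝒜 1).zero_mem
      (hab.trans (add_zero 1).symm)).1
    have e : a = 1 := EvenPart.val_injective this
    exact e ▸ ha

/-- A twist-invariant central idempotent `z` of the even part is trivial, since `z * E` is a
twist-stable ideal. -/
theorem central_eq_zero_or_one [IsScalarTower K A A] [SMulCommClass K A A]
    (h : IsOddUnit 𝒜 u r) (hA : IsAntiassociativeQuasialgebra 𝒜)
    (hsimple : IsGradedSimple 𝒜) {z : hA.EvenPart} (hz : z * z = z)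
    (hc : ∀ x, z * x = x * z) (ht : h.twist hA z = z) : z = 0 ∨ z = 1 := by
  let J : Submodule K hA.EvenPart :=
    { carrier := {x | z * x = x}
      add_mem' := fun {x y} (hx : z * x = x) (hy : z * y = y) =>
        show z * (x + y) = x + y by rw [mul_add, hx, hy]
      zero_mem' := mul_zero z
      smul_mem' := fun c x (hx : z * x = x) =>
        show z * (c • x) = c • x by rw [mul_smul_comm, hx] }
  rcases h.eq_bot_or_one_mem hA hsimple J
    (fun x a (ha : z * a = a) => show z * (x * a) = x * a by rw [← mul_assoc, hc, mul_assoc, ha])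
    (fun x a (ha : z * a = a) => show z * (a * x) = a * x by rw [← mul_assoc, ha])
    (fun a (ha : z * a = a) => show z * h.twist hA a = h.twist hA a by
      have := congrArg (h.twist hA) ha
      rwa [map_mul, ht] at this) with h0 | h1
  · left
    have : z ∈ J := hz
    rwa [h0, Submodule.mem_bot] at this
  · right
    have : z * 1 = 1 := h1
    rwa [mul_one] at this

end IsOddUnit

theorem EvenPart.isArtinianRing [IsScalarTower K A A] [SMulCommClass K A A]
    (hA : IsAntiassociativeQuasialgebra 𝒜)
    (hart : NeutralPartArtinian 𝒜) : IsArtinianRing hA.EvenPart := by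
  let φ : Ideal hA.EvenPart →
      {I : Submodule K A // I ≤ 𝒜 0 ∧ ∀ a ∈ 𝒜 0, ∀ x ∈ I, a * x ∈ I} := fun I =>
    ⟨(I.restrictScalars K).map (EvenPart.val hA), by
      rintro _ ⟨x, -, rfl⟩
      exact EvenPart.val_mem x, by
      rintro a ha _ ⟨x, hx, rfl⟩
      exact ⟨EvenPart.mk hA a ha * x, I.mul_mem_left _ hx, rfl⟩⟩
  have hφ : StrictMono φ := by
    refine Monotone.strictMono_of_injective (fun I J hIJ => Submodule.map_mono hIJ) ?_
    intro I J hIJ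
    have := Submodule.map_injective_of_injective EvenPart.val_injective (congrArg Subtype.val hIJ)
    exact Submodule.restrictScalars_injective K _ _ this
  have : WellFoundedLT {I : Submodule K A // I ≤ 𝒜 0 ∧ ∀ a ∈ 𝒜 0, ∀ x ∈ I, a * x ∈ I} := hart
  exact hφ.wellFoundedLT

/-- The Jacobson radical is twist-stable, so it vanishes and the even part is semisimple. -/
theorem EvenPart.isSemisimpleRing [IsScalarTower K A A] [SMulCommClass K A A]
    (hA : IsAntiassociativeQuasialgebra 𝒜) [Nontrivial hA.EvenPart]
    (hart : NeutralPartArtinian 𝒜) (hsimple : IsGradedSimple 𝒜) {u r : A}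
    (h : IsOddUnit 𝒜 u r) : IsSemisimpleRing hA.EvenPart := by
  have := EvenPart.isArtinianRing hA hart
  rw [IsArtinianRing.isSemisimpleRing_iff_jacobson]
  have : RingHomSurjective (h.twist hA) := ⟨h.twist_surjective hA⟩
  rcases h.eq_bot_or_one_mem hA hsimple ((Ring.jacobson hA.EvenPart).restrictScalars K)
    (fun x a ha => Ideal.mul_mem_left _ x ha) (fun x a ha => Ideal.mul_mem_right x _ ha)
    (fun a ha => Ring.le_comap_jacobson (h.twist hA) ha) with h0 | h1
  · exact (Submodule.restrictScalars_eq_bot_iff K _ _).1 h0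
  · exact absurd ((Ideal.eq_top_iff_one _).2 h1) (Module.jacobson_lt_top _ _).ne

/-- The identity of a matrix block of the even part and its twist are equal or complementary. -/
theorem IsMatrixBlock.one_eq_or [IsScalarTower K A A] [SMulCommClass K A A]
    (hA : IsAntiassociativeQuasialgebra 𝒜) (hsimple : IsGradedSimple 𝒜) {u r : A}
    (h : IsOddUnit 𝒜 u r) {n : ℕ} [NeZero n] {D : Type*} [DivisionRing D] [Algebra K D]
    {ι : Matrix (Fin n) (Fin n) D →ₗ[K] hA.EvenPart} (hι : IsMatrixBlock ι) :
    ι 1 = 1 ∨ ι 1 + h.twist hA (ι 1) = 1 := by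
  obtain ⟨ε, hε⟩ : ∃ ε, ε = ι 1 := ⟨_, rfl⟩
  obtain ⟨τ, hτ⟩ : ∃ τ, τ = h.twist hA ε := ⟨_, rfl⟩
  have hεε : ε * ε = ε := hε ▸ hι.one_mul_map 1
  have hε0 : ε ≠ 0 := hε ▸ hι.map_one_ne_zero
  have hεc : ∀ x, ε * x = x * ε := hε ▸ hι.commute
  have hττ : τ * τ = τ := by rw [hτ, ← _root_.map_mul, hεε]
  have hτc : ∀ x, τ * x = x * τ := fun x => by
    obtain ⟨y, rfl⟩ := h.twist_surjective hA x
    rw [hτ, ← _root_.map_mul, hεc, _root_.map_mul]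
  have hτε : h.twist hA τ = ε := by rw [hτ, h.twist_twist hA hεc]
  have key := hι.mul_map_one_eq hττ hτc
  rw [← hε] at key ⊢
  rw [← hτ]
  rcases key with h0 | h1
  · right
    refine (h.central_eq_zero_or_one hA hsimple (z := ε + τ) ?_ ?_ ?_).resolve_left ?_
    · rw [add_mul, mul_add, mul_add, hεε, hεc τ, h0, hττ, add_zero, zero_add]
    · intro x
      rw [add_mul, mul_add, hεc, hτc]
    · rw [map_add, hτε, ← hτ, add_comm]
    · intro hz
      apply hε0
      have : (ε + τ) * ε = ε := by rw [add_mul, hεε, h0, add_zero]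
      rw [← this, hz, zero_mul]
  · left
    have h2 := congrArg (h.twist hA) h1
    rw [_root_.map_mul, hτε, ← hτ, hεc, h1] at h2
    exact (h.central_eq_zero_or_one hA hsimple hεε hεc (hτ.symm.trans h2.symm)).resolve_left hε0

end OddUnit

/-! ### Recognition of the chess-board algebra -/

/-- Odd elements `v`, `w` that exchange an idempotent `ε` with its complement `1 - ε`. The sign
in `w * v = -(1 - ε)` is forced by antiassociativity, and it is the sign in the product of the
chess-board algebra. -/
structure IsOddSwap {K A : Type*} [Field K] [NonAssocRing A] [Module K A]
    (𝒜 : ZMod 2 → Submodule K A) (ε v w : A) : Prop where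
  left_mem : v ∈ 𝒜 1
  right_mem : w ∈ 𝒜 1
  idem_mul_left : ε * v = v
  left_mul_idem : v * ε = 0
  idem_mul_right : ε * w = 0
  right_mul_idem : w * ε = w
  left_mul_right : v * w = ε
  right_mul_left : w * v = -(1 - ε)

section Chess

variable {K : Type u} [Field K] {A : Type v} [NonAssocRing A] [Module K A]
  {𝒜 : ZMod 2 → Submodule K A}

/-- The components `ε u` and `u⁻¹ ε` of an odd unit `u` exchange a block identity `ε` with its
complement, if the latter is the twist of `ε`. -/
theorem IsOddUnit.isOddSwap {u r : A} (h : IsOddUnit 𝒜 u r)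
    (hA : IsAntiassociativeQuasialgebra 𝒜) {ε : hA.EvenPart} (hεε : ε * ε = ε)
    (hadd : ε + h.twist hA ε = 1) :
    IsOddSwap 𝒜 (EvenPart.val hA ε) (EvenPart.val hA ε * u) (r * EvenPart.val hA ε) := by
  obtain ⟨τ, hτ⟩ : ∃ τ, τ = h.twist hA ε := ⟨_, rfl⟩
  have huε : u * EvenPart.val hA ε = EvenPart.val hA τ * u := by rw [hτ, h.twist_mul hA]
  rw [← hτ] at hadd
  have hετ : EvenPart.val hA ε * EvenPart.val hA τ = 0 := by
    rw [← EvenPart.val_mul, eq_sub_of_add_eq' hadd, mul_sub, hεε, mul_one, sub_self, map_zero]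
  have hτ1 : EvenPart.val hA τ = 1 - EvenPart.val hA ε := by
    rw [eq_sub_of_add_eq' hadd, map_sub, EvenPart.val_one]
  have hε' : EvenPart.val hA ε * EvenPart.val hA ε = EvenPart.val hA ε :=
    congrArg (EvenPart.val hA) hεε
  have hε0 := EvenPart.val_mem ε
  have hτ0 := EvenPart.val_mem τ
  generalize EvenPart.val hA ε = e at *
  generalize EvenPart.val hA τ = t at *
  have heN := hA.isNuclear hε0
  have htN := hA.isNuclear hτ0
  -- conjugating `u e = t u` by the inverse of `u`
  have hrt : r * t = e * r := by
    have h1 : (r * t) * u = -e := by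
      rw [htN.mid, ← huε, ← heN.right, h.inv_mul, neg_one_mul]
    have h2 := h.mul_mul_inv hA (hA.odd_mul_even h.inv_mem hτ0)
    rw [h1, neg_mul] at h2
    exact (neg_injective h2).symm
  have hre : r * e = t * r := by
    have h1 : r * t = r - r * e := by rw [hτ1, mul_sub, mul_one]
    rw [hτ1, sub_mul, one_mul, ← hrt, h1, sub_sub_cancel]
  refine ⟨hA.even_mul_odd hε0 h.mem, hA.odd_mul_even h.inv_mem hε0, ?_, ?_, ?_, ?_, ?_, ?_⟩
  · rw [← heN.left, hε']
  · rw [heN.left, huε, ← heN.left, hετ, zero_mul]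
  · rw [hre, ← heN.left, hετ, zero_mul]
  · rw [heN.mid, hε']
  · rw [← heN.right, heN.left, h.mul_inv, mul_one, hε']
  · rw [heN.mid, ← heN.left e u, hε', ← heN.mid, hre, htN.left, h.inv_mul, mul_neg, mul_one, hτ1]

variable [IsScalarTower K A A] [SMulCommClass K A A]

/-- If a matrix block `ι` of the even part is exchanged with its complement by odd elements `v`
and `w`, then `(a, x, y, b) ↦ ι a + (ι x) v + w (ι y) - (w (ι b)) v` is an isomorphism from the
chess-board algebra. -/
theorem gradedIso_chess (hA : IsAntiassociativeQuasialgebra 𝒜) {n : ℕ} {D : Type*}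
    [DivisionRing D] [Algebra K D] {ι : Matrix (Fin n) (Fin n) D →ₗ[K] hA.EvenPart}
    (hι : IsMatrixBlock ι) {v w : A} (h : IsOddSwap 𝒜 (EvenPart.val hA (ι 1)) v w) :
    GradedIso 𝒜 (ChessMat.grading K n n D) := by
  obtain ⟨ε, hε⟩ : ∃ ε, ε = EvenPart.val hA (ι 1) := ⟨_, rfl⟩
  rw [← hε] at h
  obtain ⟨hv, hw, hεv, hvε, hεw, hwε, hvw, hwv⟩ := h
  let i : Matrix (Fin n) (Fin n) D →ₗ[K] A := EvenPart.val hA ∘ₗ ι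
  have hi0 : ∀ M, i M ∈ 𝒜 0 := fun M => EvenPart.val_mem _
  have hiN : ∀ M, IsNuclear (i M) := fun M => hA.isNuclear (hi0 M)
  have himul : ∀ M N, i (M * N) = i M * i N := fun M N => by
    change EvenPart.val hA (ι (M * N)) = _
    rw [hι.map_mul]
    rfl
  have hinj : Function.Injective i := EvenPart.val_injective.comp hι.injective
  have hεi : ∀ M, ε * i M = i M := fun M => hε ▸ congrArg (EvenPart.val hA) (hι.one_mul_map M)
  have hiε : ∀ M, i M * ε = i M := fun M => hε ▸ congrArg (EvenPart.val hA) (hι.map_mul_one M)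
  have hε0 : ε ∈ 𝒜 0 := hε ▸ EvenPart.val_mem _
  have hεN : IsNuclear ε := hA.isNuclear hε0
  have hεc : ∀ x ∈ 𝒜 0, ε * x = x * ε := fun x hx => by
    rw [hε]
    exact congrArg (EvenPart.val hA) (hι.commute (EvenPart.mk hA x hx))
  have hsurj : ∀ x ∈ 𝒜 0, ε * x = x → ∃ M, i M = x := fun x hx hεx => by
    obtain ⟨M, hM⟩ := hι.exists_eq (x := EvenPart.mk hA x hx)
      (EvenPart.val_injective (by rw [EvenPart.val_mul, ← hε]; exact hεx))
    exact ⟨M, congrArg (EvenPart.val hA) hM⟩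
  have hiv : ∀ M, i M * v ∈ 𝒜 1 := fun M => hA.even_mul_odd (hi0 M) hv
  have hwi : ∀ M, w * i M ∈ 𝒜 1 := fun M => hA.odd_mul_even hw (hi0 M)
  have hwiv : ∀ M, (w * i M) * v ∈ 𝒜 0 := fun M => hA.odd_mul_odd (hwi M) hv
  -- cancellation rules for adjacent factors
  have vi : ∀ M, v * i M = 0 := fun M => by rw [← hεi, ← hεN.mid, hvε, zero_mul]
  have iw : ∀ M, i M * w = 0 := fun M => by rw [← hiε, hεN.mid, hεw, mul_zero]
  have vw : ∀ M, v * (w * i M) = i M := fun M => by rw [← (hiN M).right, hvw, hεi]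
  have iv_w : ∀ M, (i M * v) * w = i M := fun M => by rw [(hiN M).left, hvw, hiε]
  have v_wiv : ∀ M, v * ((w * i M) * v) = -(i M * v) := fun M => by
    have := hA.odd_assoc hv (hwi M) hv
    rw [vw] at this
    rw [this, neg_neg]
  have v_iv : ∀ M, v * (i M * v) = 0 := fun M => by rw [← (hiN M).mid, vi, zero_mul]
  have wi_w : ∀ M, (w * i M) * w = 0 := fun M => by rw [(hiN M).mid, iw, mul_zero]
  -- the products of the four kinds of blocks
  have p12 : ∀ M N, i M * (i N * v) = i (M * N) * v := fun M N => by
    rw [← (hiN M).left, himul]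
  have p13 : ∀ M N, i M * (w * i N) = 0 := fun M N => by
    rw [← (hiN M).left, iw, zero_mul]
  have p14 : ∀ M N, i M * ((w * i N) * v) = 0 := fun M N => by
    rw [← (hiN M).left, p13, zero_mul]
  have p21 : ∀ M N, (i M * v) * i N = 0 := fun M N => by
    rw [(hiN M).left, vi, mul_zero]
  have p22 : ∀ M N, (i M * v) * (i N * v) = 0 := fun M N => by
    rw [(hiN M).left, v_iv, mul_zero]
  have p23 : ∀ M N, (i M * v) * (w * i N) = i (M * N) := fun M N => by
    rw [(hiN M).left, vw, himul]
  have p24 : ∀ M N, (i M * v) * ((w * i N) * v) = -(i (M * N) * v) := fun M N => by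
    rw [(hiN M).left, v_wiv, mul_neg, p12]
  have p31 : ∀ M N, (w * i M) * i N = w * i (M * N) := fun M N => by
    rw [(hiN N).right, himul]
  have p32 : ∀ M N, (w * i M) * (i N * v) = (w * i (M * N)) * v := fun M N => by
    rw [← (hiN N).mid, p31]
  have p33 : ∀ M N, (w * i M) * (w * i N) = 0 := fun M N => by
    rw [(hiN M).mid, p13, mul_zero]
  have p34 : ∀ M N, (w * i M) * ((w * i N) * v) = 0 := fun M N => by
    rw [(hiN M).mid, p14, mul_zero]
  have p41 : ∀ M N, ((w * i M) * v) * i N = 0 := fun M N => by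
    rw [(hiN N).right, vi, mul_zero]
  have p42 : ∀ M N, ((w * i M) * v) * (i N * v) = 0 := fun M N => by
    rw [← (hiN N).mid, p41, zero_mul]
  have p43 : ∀ M N, ((w * i M) * v) * (w * i N) = -(w * i (M * N)) := fun M N => by
    rw [hA.odd_assoc (hwi M) hv (hwi N), vw, p31]
  have p44 : ∀ M N, ((w * i M) * v) * ((w * i N) * v) = -((w * i (M * N)) * v) := fun M N => by
    rw [← (hA.isNuclear (hwiv M)).left, p43, neg_mul]
  let Φ : ChessMat n n D →ₗ[K] A :=
    { toFun := fun X => i X.a + i X.v * v + w * i X.w - (w * i X.b) * v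
      map_add' := fun X Y => by
        simp only [ChessMat.add_def, map_add, add_mul, mul_add]
        abel
      map_smul' := fun c X => by
        simp only [ChessMat.smul_def, map_smul, smul_add, smul_sub, smul_mul_assoc,
          mul_smul_comm, RingHom.id_apply] }
  have hΦ : ∀ X, Φ X = i X.a + i X.v * v + w * i X.w - (w * i X.b) * v := fun _ => rfl
  have hΦmul : ∀ X Y, Φ (X * Y) = Φ X * Φ Y := fun X Y => by
    simp only [hΦ, ChessMat.mul_def, map_add, map_neg, sub_eq_add_neg, add_mul, mul_add, neg_mul,
      mul_neg, p12, p13, p14, p21, p22, p23, p24, p31, p32, p33, p34, p41, p42, p43, p44, himul,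
      neg_neg, neg_add, neg_zero, add_zero, zero_add]
    abel
  have hΦ0 : ∀ X, Φ X = (i X.a - (w * i X.b) * v) + (i X.v * v + w * i X.w) := fun X => by
    rw [hΦ]; abel
  have hev : ∀ X : ChessMat n n D, i X.a - (w * i X.b) * v ∈ 𝒜 0 := fun X =>
    (𝒜 0).sub_mem (hi0 _) (hwiv _)
  have hod : ∀ X : ChessMat n n D, i X.v * v + w * i X.w ∈ 𝒜 1 := fun X =>
    (𝒜 1).add_mem (hiv _) (hwi _)
  have hΦinj : ∀ X, Φ X = 0 → X = 0 := fun X hX => by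
    rw [hΦ0, ← add_zero (0 : A)] at hX
    obtain ⟨e0, e1⟩ := hA.eq_of_add_eq (hev X) (𝒜 0).zero_mem (hod X) (𝒜 1).zero_mem hX
    have ha : i X.a = 0 := by
      have := congrArg (ε * ·) e0
      simp only [mul_sub, mul_zero, hεi] at this
      rwa [← hεN.left, ← hεN.left, hεw, zero_mul, zero_mul, sub_zero] at this
    have hb : i X.b = 0 := by
      rw [ha, zero_sub, neg_eq_zero] at e0
      have := v_wiv X.b
      rw [e0, mul_zero, zero_eq_neg] at this
      rw [← iv_w, this, zero_mul]
    have hx : i X.v = 0 := by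
      have := congrArg (ε * ·) e1
      simp only [mul_add, mul_zero] at this
      rw [← hεN.left, ← hεN.left, hεi, hεw, zero_mul, add_zero] at this
      rw [← iv_w, this, zero_mul]
    have hy : i X.w = 0 := by
      rw [hx, zero_mul, zero_add] at e1
      rw [← vw, e1, mul_zero]
    have z : ∀ M, i M = 0 → M = 0 := fun M hM => hinj (hM.trans (map_zero i).symm)
    ext1
    exacts [z _ ha, z _ hx, z _ hy, z _ hb]
  have hεε : ε * ε = ε := by
    rw [hε]
    exact congrArg (EvenPart.val hA) (hι.one_mul_map 1)
  have hwv' : ∀ x ∈ 𝒜 1, w * (v * x) = x - ε * x := fun x hx => by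
    rw [← neg_eq_iff_eq_neg.2 (hA.odd_assoc hw hv hx), hwv, neg_mul, neg_neg, sub_mul, one_mul]
  have hsurj0 : ∀ x ∈ 𝒜 0, ∃ X ∈ ChessMat.grading K n n D 0, Φ X = x := fun x hx => by
    have hxw : x * w ∈ 𝒜 1 := hA.even_mul_odd hx hw
    obtain ⟨a, ha⟩ := hsurj (ε * x) (hA.even_mul_even hε0 hx) (by rw [← hεN.left, hεε])
    obtain ⟨b, hb⟩ := hsurj (v * (x * w)) (hA.odd_mul_odd hv hxw) (by rw [← hεN.left, hεv])
    refine ⟨⟨a, 0, 0, b⟩, ⟨rfl, rfl⟩, ?_⟩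
    rw [hΦ]
    simp only [ha, hb, map_zero, zero_mul, mul_zero, add_zero]
    rw [hwv' _ hxw, ← hεN.left, hεc x hx, hεN.mid, hεw, mul_zero, sub_zero,
      (hA.isNuclear hx).left, hwv, mul_neg, mul_sub, mul_one]
    abel
  have hsurj1 : ∀ x ∈ 𝒜 1, ∃ X ∈ ChessMat.grading K n n D 1, Φ X = x := fun x hx => by
    have hεx : ε * x ∈ 𝒜 1 := hA.even_mul_odd hε0 hx
    -- `ε x ε = 0`, since the even element `x v` commutes with `ε`
    have hεxε : (ε * x) * ε = 0 := by
      have h0 : (ε * x) * v = 0 := by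
        rw [hεN.left, hεc _ (hA.odd_mul_odd hx hv), hεN.right, hvε, mul_zero]
      have := hA.odd_assoc hεx hv hw
      rwa [h0, zero_mul, hvw, zero_eq_neg] at this
    obtain ⟨a, ha⟩ := hsurj ((ε * x) * w) (hA.odd_mul_odd hεx hw) (by
      rw [← hεN.left, ← hεN.left, hεε])
    obtain ⟨b, hb⟩ := hsurj (v * x) (hA.odd_mul_odd hv hx) (by rw [← hεN.left, hεv])
    refine ⟨⟨0, a, b, 0⟩, ⟨rfl, rfl⟩, ?_⟩
    rw [hΦ]
    simp only [ha, hb, map_zero, zero_mul, mul_zero, sub_zero, zero_add]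
    rw [hwv' _ hx, hA.odd_assoc hεx hw hv, hwv, mul_neg, neg_neg, mul_sub, mul_one, hεxε]
    abel
  have hΦsurj : Function.Surjective Φ := fun x => by
    obtain ⟨x0, hx0, x1, hx1, rfl⟩ := hA.exists_add x
    obtain ⟨X0, -, rfl⟩ := hsurj0 x0 hx0
    obtain ⟨X1, -, rfl⟩ := hsurj1 x1 hx1
    exact ⟨X0 + X1, map_add Φ X0 X1⟩
  let e := LinearEquiv.ofBijective Φ ⟨(injective_iff_map_eq_zero Φ).2 hΦinj, hΦsurj⟩
  have he : ∀ X, e X = Φ X := fun _ => rfl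
  refine GradedIso.of_linearEquiv e.symm (fun x y => e.injective ?_) (fun g x hx => ?_)
    (fun g X hX => ?_)
  · rw [LinearEquiv.apply_symm_apply, he, hΦmul, ← he, ← he, LinearEquiv.apply_symm_apply,
      LinearEquiv.apply_symm_apply]
  · obtain ⟨X, hX, rfl⟩ : ∃ X ∈ ChessMat.grading K n n D g, Φ X = x := by
      fin_cases g
      exacts [hsurj0 x hx, hsurj1 x hx]
    rwa [← he, LinearEquiv.symm_apply_apply]
  · rw [LinearEquiv.symm_symm, he, hΦ0]
    fin_cases g
    · obtain ⟨h1, h2⟩ : X.v = 0 ∧ X.w = 0 := hX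
      rw [h1, h2, map_zero, zero_mul, mul_zero, add_zero, add_zero]
      exact hev X
    · obtain ⟨h1, h2⟩ : X.a = 0 ∧ X.b = 0 := hX
      rw [h1, h2, map_zero, mul_zero, zero_mul, sub_zero, zero_add]
      exact hod X

end Chess

/-! ### Corners at even idempotents -/

section Corner

variable {K : Type u} [Field K] {A : Type v} [NonAssocRing A] [Module K A] [IsScalarTower K A A]
  [SMulCommClass K A A] {𝒜 : ZMod 2 → Submodule K A}

/-- The corner `e * A * e`, as the set of all `x` with `e * x = x` and `x * e = x`. -/
def cornerSubmodule (K : Type*) {A : Type*} [Field K] [NonAssocRing A] [Module K A]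
    [IsScalarTower K A A] [SMulCommClass K A A] (e : A) : Submodule K A where
  carrier := {x | e * x = x ∧ x * e = x}
  add_mem' {x y} hx hy := ⟨by rw [mul_add, hx.1, hy.1], by rw [add_mul, hx.2, hy.2]⟩
  zero_mem' := ⟨mul_zero e, zero_mul e⟩
  smul_mem' c x hx := ⟨by rw [mul_smul_comm, hx.1], by rw [smul_mul_assoc, hx.2]⟩

/-- The corner at a nuclear idempotent `e`, as an algebra with identity `e`. -/
def NuclearCorner (K : Type*) {A : Type*} [Field K] [NonAssocRing A] [Module K A]
    [IsScalarTower K A A] [SMulCommClass K A A] {e : A} (_ : IsNuclear e) (_ : e * e = e) :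
    Type _ := cornerSubmodule K e

namespace NuclearCorner

variable {e : A} {he : IsNuclear e} {hee : e * e = e}

instance : AddCommGroup (NuclearCorner K he hee) :=
  inferInstanceAs (AddCommGroup (cornerSubmodule K e))

instance : Module K (NuclearCorner K he hee) :=
  inferInstanceAs (Module K (cornerSubmodule K e))

/-- The inclusion of the corner. -/
def val : NuclearCorner K he hee →ₗ[K] A := (cornerSubmodule K e).subtype

theorem val_injective : Function.Injective (val : NuclearCorner K he hee →ₗ[K] A) :=
  Subtype.val_injective

/-- An element of the corner, given by an element of the algebra. -/
def mk (x : A) (h1 : e * x = x) (h2 : x * e = x) : NuclearCorner K he hee := ⟨x, h1, h2⟩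

@[simp] theorem val_mk (x : A) (h1 : e * x = x) (h2 : x * e = x) :
    val (mk x h1 h2 : NuclearCorner K he hee) = x := rfl

theorem mul_val (x : NuclearCorner K he hee) : e * val x = val x := x.2.1

theorem val_mul_idem (x : NuclearCorner K he hee) : val x * e = val x := x.2.2

instance : Mul (NuclearCorner K he hee) :=
  ⟨fun x y => mk (val x * val y) (by rw [← he.left, mul_val])
    (by rw [he.right, val_mul_idem])⟩

instance : One (NuclearCorner K he hee) := ⟨mk e hee hee⟩

@[simp] theorem val_mul (x y : NuclearCorner K he hee) : val (x * y) = val x * val y := rfl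

@[simp] theorem val_one : val (1 : NuclearCorner K he hee) = e := rfl

instance : NonAssocRing (NuclearCorner K he hee) :=
  { (inferInstance : AddCommGroup (NuclearCorner K he hee)) with
    mul := (· * ·)
    one := 1
    left_distrib := fun x y z => val_injective (by simp [mul_add])
    right_distrib := fun x y z => val_injective (by simp [add_mul])
    zero_mul := fun x => val_injective (by simp)
    mul_zero := fun x => val_injective (by simp)
    one_mul := fun x => val_injective (by simp [mul_val])
    mul_one := fun x => val_injective (by simp [val_mul_idem]) }

instance : IsScalarTower K (NuclearCorner K he hee) (NuclearCorner K he hee) :=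
  ⟨fun c x y => val_injective (by simp [smul_mul_assoc])⟩

instance : SMulCommClass K (NuclearCorner K he hee) (NuclearCorner K he hee) :=
  ⟨fun c x y => val_injective (by simp [mul_smul_comm])⟩

/-- The grading of a corner inherited from the grading of the algebra. -/
def grading (𝒜 : ZMod 2 → Submodule K A) (he : IsNuclear e) (hee : e * e = e) (g : ZMod 2) :
    Submodule K (NuclearCorner K he hee) := (𝒜 g).comap val

theorem isAntiassociativeQuasialgebra (hA : IsAntiassociativeQuasialgebra 𝒜) (he0 : e ∈ 𝒜 0) :
    IsAntiassociativeQuasialgebra (grading 𝒜 he hee) where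
  isCocycle := antiassocCocycle_isCocycle K
  isInternal := by
    rw [DirectSum.isInternal_submodule_iff_isCompl _ (i := 0) (j := 1) (by decide)
      (by ext x; revert x; decide)]
    refine IsCompl.of_le (fun x hx => ?_) (fun x _ => ?_)
    · exact val_injective ((hA.eq_zero hx.1 hx.2).trans (map_zero _).symm)
    · obtain ⟨a, ha, b, hb, hab⟩ := hA.exists_add (val x)
      -- multiplication by `e` respects the homogeneous components
      have hl := hA.eq_of_add_eq (hA.even_mul_even he0 ha) ha (hA.even_mul_odd he0 hb) hb
        (by rw [← mul_add, hab, mul_val])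
      have hr := hA.eq_of_add_eq (hA.even_mul_even ha he0) ha (hA.odd_mul_even hb he0) hb
        (by rw [← add_mul, hab, val_mul_idem])
      exact Submodule.mem_sup.2 ⟨mk a hl.1 hr.1, ha, mk b hl.2 hr.2, hb, val_injective hab⟩
  mul_mem g h x hx y hy := hA.mul_mem g h _ hx _ hy
  quasiassoc g h k x hx y hy z hz := val_injective (by
    simpa using hA.quasiassoc g h k _ hx _ hy _ hz)

end NuclearCorner

/-- Let the even part be a single matrix block `Mat_n(D)`, let `A` have an odd unit, and let `e`
be the first diagonal matrix unit. Then the corner at `e` is a division antiassociative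
quasialgebra: an odd `x ≠ 0` in it becomes an even element `x u ≠ 0`, which can be moved back
into the corner by primeness of the even part. -/
theorem isDivisionAntiassociative_nuclearCorner (hA : IsAntiassociativeQuasialgebra 𝒜)
    {u r : A} (h : IsOddUnit 𝒜 u r) {n : ℕ} [NeZero n] {D : Type*} [DivisionRing D] [Algebra K D]
    {ι : Matrix (Fin n) (Fin n) D →ₗ[K] hA.EvenPart} (hι : IsMatrixBlock ι) (hone : ι 1 = 1)
    {e : A} (he : IsNuclear e) (hee : e * e = e)
    (heq : e = EvenPart.val hA (ι (Matrix.single 0 0 1))) :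
    IsDivisionAntiassociative (NuclearCorner.grading 𝒜 he hee) := by
  have he0 : e ∈ 𝒜 0 := heq ▸ EvenPart.val_mem _
  let i : Matrix (Fin n) (Fin n) D →ₗ[K] A := EvenPart.val hA ∘ₗ ι
  have himul : ∀ M N, i (M * N) = i M * i N := fun M N => by
    change EvenPart.val hA (ι (M * N)) = _
    rw [hι.map_mul]
    rfl
  have hinj : Function.Injective i := EvenPart.val_injective.comp hι.injective
  have hsurj : ∀ x ∈ 𝒜 0, ∃ M, i M = x := fun x hx => by
    obtain ⟨M, hM⟩ := hι.exists_eq (x := EvenPart.mk hA x hx) (by rw [hone, one_mul])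
    exact ⟨M, congrArg (EvenPart.val hA) hM⟩
  have hie : i (Matrix.single 0 0 1) = e := heq.symm
  have hene : e ≠ 0 := by
    rw [← hie]
    exact fun h0 => Matrix.single_one_ne_zero 0 (hinj (h0.trans (map_zero i).symm))
  have prime : ∀ x ∈ 𝒜 0, ∀ y ∈ 𝒜 0, x ≠ 0 → y ≠ 0 → ∃ b ∈ 𝒜 0, (x * b) * y ≠ 0 := by
    intro x hx y hy hx0 hy0
    obtain ⟨M, rfl⟩ := hsurj x hx
    obtain ⟨N, rfl⟩ := hsurj y hy
    obtain ⟨R, hR⟩ := Matrix.exists_mul_mul_ne_zero M N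
      (fun h0 => hx0 (by rw [h0, map_zero])) (fun h0 => hy0 (by rw [h0, map_zero]))
    refine ⟨i R, EvenPart.val_mem _, ?_⟩
    rw [← himul, ← himul]
    exact fun h0 => hR (hinj (h0.trans (map_zero i).symm))
  -- the even part of the corner is a copy of `D`
  have hinv : ∀ x ∈ 𝒜 0, e * x = x → x * e = x → x ≠ 0 →
      ∃ y ∈ 𝒜 0, e * y = y ∧ y * e = y ∧ x * y = e ∧ y * x = e := by
    intro x hx hx1 hx2 hx0
    obtain ⟨M, rfl⟩ := hsurj x hx
    have hM : M = Matrix.single 0 0 (M 0 0) := by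
      apply hinj
      rw [← one_mul (M 0 0), ← mul_one (1 * M 0 0), ← Matrix.single_diag_mul_mul_single_diag,
        himul, himul, hie, hx1, hx2]
    have hd : M 0 0 ≠ 0 := fun h0 => hx0 (by rw [hM, h0, Matrix.single_zero, map_zero])
    refine ⟨i (Matrix.single 0 0 (M 0 0)⁻¹), EvenPart.val_mem _, ?_, ?_, ?_, ?_⟩
    · rw [← hie, ← himul, Matrix.single_mul_single_same, one_mul]
    · rw [← hie, ← himul, Matrix.single_mul_single_same, mul_one]
    · rw [hM, ← himul, Matrix.single_apply_same, Matrix.single_mul_single_same,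
        mul_inv_cancel₀ hd, hie]
    · rw [hM, ← himul, Matrix.single_apply_same, Matrix.single_mul_single_same,
        inv_mul_cancel₀ hd, hie]
  refine ⟨NuclearCorner.isAntiassociativeQuasialgebra hA he0, ⟨0, 1, fun h0 => hene
    (congrArg NuclearCorner.val h0).symm⟩, fun g x hx hx0 => ?_⟩
  have hxA : NuclearCorner.val x ∈ 𝒜 g := hx
  have hx0' : NuclearCorner.val x ≠ 0 := fun h0 =>
    hx0 (NuclearCorner.val_injective (h0.trans (map_zero _).symm))
  have hx1 := NuclearCorner.mul_val x
  have hx2 := NuclearCorner.val_mul_idem x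
  obtain rfl | rfl : g = 0 ∨ g = 1 :=
    (by decide : ∀ g : ZMod 2, g = 0 ∨ g = 1) g
  · obtain ⟨y, -, hy1, hy2, hxy, hyx⟩ := hinv _ hxA hx1 hx2 hx0'
    exact ⟨⟨NuclearCorner.mk y hy1 hy2, NuclearCorner.val_injective hyx⟩,
      ⟨NuclearCorner.mk y hy1 hy2, NuclearCorner.val_injective hxy⟩⟩
  · obtain ⟨x, hxv⟩ : ∃ x', x' = NuclearCorner.val x := ⟨_, rfl⟩
    rw [← hxv] at hxA hx0' hx1 hx2
    constructor
    · obtain ⟨b, hb, hb0⟩ := prime e he0 (u * x) (hA.odd_mul_odd h.mem hxA) hene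
        (fun h0 => hx0' (by rw [← h.inv_mul_mul hA hxA, h0, mul_zero]))
      obtain ⟨y, hy⟩ : ∃ y, y = (e * (b * u)) * e := ⟨_, rfl⟩
      have hey : e * y = y := by rw [hy, ← he.left, ← he.left, hee]
      have hye : y * e = y := by rw [hy, he.mid, hee]
      have hyA : y ∈ 𝒜 1 :=
        hy ▸ hA.odd_mul_even (hA.even_mul_odd he0 (hA.even_mul_odd hb h.mem)) he0
      have hyx : y * x = (e * b) * (u * x) := by
        rw [hy, he.mid, hx1, he.left, (hA.isNuclear hb).left, he.left]
      obtain ⟨d, hd, hd1, hd2, -, hdx⟩ := hinv (y * x) (hA.odd_mul_odd hyA hxA)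
        (by rw [← he.left, hey]) (by rw [he.right, hx2]) (hyx ▸ hb0)
      refine ⟨NuclearCorner.mk (d * y) (by rw [← he.left, hd1]) (by rw [he.right, hye]),
        NuclearCorner.val_injective ?_⟩
      rw [NuclearCorner.val_mul, NuclearCorner.val_mk, ← hxv, (hA.isNuclear hd).left, hdx]
      rfl
    · obtain ⟨b, hb, hb0⟩ := prime (x * u) (hA.odd_mul_odd hxA h.mem) e he0
        (fun h0 => hx0' (by
          have := h.mul_mul_inv hA hxA
          rw [h0, zero_mul, zero_eq_neg] at this
          exact this)) hene
      obtain ⟨y, hy⟩ : ∃ y, y = e * ((u * b) * e) := ⟨_, rfl⟩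
      have hey : e * y = y := by rw [hy, ← he.left, hee]
      have hye : y * e = y := by rw [hy, he.right, he.right, hee]
      have hyA : y ∈ 𝒜 1 :=
        hy ▸ hA.even_mul_odd he0 (hA.odd_mul_even (hA.odd_mul_even h.mem hb) he0)
      have hxy : x * y = ((x * u) * b) * e := by
        rw [hy, ← he.mid, hx2, ← he.right, (hA.isNuclear hb).right]
      obtain ⟨d, hd, hd1, hd2, hxd, -⟩ := hinv (x * y) (hA.odd_mul_odd hxA hyA)
        (by rw [← he.left, hx1]) (by rw [he.right, hye]) (hxy ▸ hb0)
      refine ⟨NuclearCorner.mk (y * d) (by rw [← he.left, hey]) (by rw [he.right, hd2]),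
        NuclearCorner.val_injective ?_⟩
      rw [NuclearCorner.val_mul, NuclearCorner.val_mk, ← hxv, ← (hA.isNuclear hd).right, hxd]
      rfl

/-- A full system of even matrix units identifies `A` with the matrix algebra over the corner at
the first diagonal matrix unit, by `a ↦ (s₀ᵢ a sⱼ₀)`. -/
theorem gradedIso_matrix_nuclearCorner (hA : IsAntiassociativeQuasialgebra 𝒜) {n : ℕ} [NeZero n]
    (s : Fin n → Fin n → A) (hs0 : ∀ i j, s i j ∈ 𝒜 0)
    (hmul : ∀ i j k l, s i j * s k l = if j = k then s i l else 0) (hsum : ∑ i, s i i = 1)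
    (he : IsNuclear (s 0 0)) (hee : s 0 0 * s 0 0 = s 0 0) :
    GradedIso 𝒜 (matrixGrading n (NuclearCorner.grading 𝒜 he hee)) := by
  have hN : ∀ i j, IsNuclear (s i j) := fun i j => hA.isNuclear (hs0 i j)
  have hsame : ∀ i j k, s i j * s j k = s i k := fun i j k => by rw [hmul, if_pos rfl]
  have hsame' : ∀ i j k x, s i j * (s j k * x) = s i k * x := fun i j k x => by
    rw [← (hN i j).left, hsame]
  let T : A →ₗ[K] Matrix (Fin n) (Fin n) (NuclearCorner K he hee) :=
    { toFun := fun a => Matrix.of fun i j => NuclearCorner.mk (s 0 i * (a * s j 0))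
        (by rw [hsame']) (by rw [(hN 0 0).right, (hN 0 0).right, hsame])
      map_add' := fun a b => by
        ext i j
        apply NuclearCorner.val_injective
        simp [add_mul, mul_add]
      map_smul' := fun c a => by
        ext i j
        apply NuclearCorner.val_injective
        simp [smul_mul_assoc, mul_smul_comm] }
  have hT : ∀ a i j, NuclearCorner.val (T a i j) = s 0 i * (a * s j 0) := fun _ _ _ => rfl
  let S : Matrix (Fin n) (Fin n) (NuclearCorner K he hee) →ₗ[K] A :=
    { toFun := fun M => ∑ i, ∑ j, s i 0 * (NuclearCorner.val (M i j) * s 0 j)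
      map_add' := fun M N => by
        simp only [Matrix.add_apply, map_add, add_mul, mul_add, Finset.sum_add_distrib]
      map_smul' := fun c M => by
        simp only [Matrix.smul_apply, map_smul, smul_mul_assoc, mul_smul_comm, Finset.smul_sum,
          RingHom.id_apply] }
  have hS : ∀ M, S M = ∑ i, ∑ j, s i 0 * (NuclearCorner.val (M i j) * s 0 j) := fun _ => rfl
  have hST : ∀ a, S (T a) = a := fun a => by
    rw [hS]
    have : ∀ i j, s i 0 * (NuclearCorner.val (T a i j) * s 0 j) = s i i * (a * s j j) :=
      fun i j => by
        rw [hT, (hN 0 i).left, hsame', (hN 0 j).right, hsame]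
    simp only [this, ← Finset.mul_sum, hsum, mul_one]
    rw [← Finset.sum_mul, hsum, one_mul]
  have hTS : ∀ M, T (S M) = M := fun M => by
    ext i j
    apply NuclearCorner.val_injective
    rw [hT, hS]
    have : ∀ k l, s 0 i * (s k 0 * (NuclearCorner.val (M k l) * s 0 l) * s j 0) =
        if i = k then (if l = j then NuclearCorner.val (M k l) else 0) else 0 := fun k l => by
      rw [(hN k 0).left, (hN j 0).right, ← (hN 0 i).left, hmul, hmul]
      split_ifs with h1 h2 h2
      · rw [NuclearCorner.val_mul_idem, NuclearCorner.mul_val]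
      · rw [mul_zero, mul_zero]
      · rw [zero_mul]
      · rw [zero_mul]
    simp only [Finset.sum_mul, Finset.mul_sum, this]
    simp
  let f : A ≃ₗ[K] Matrix (Fin n) (Fin n) (NuclearCorner K he hee) :=
    LinearEquiv.ofLinearMap T S (LinearMap.ext hTS) (LinearMap.ext hST)
  refine GradedIso.of_linearEquiv f (fun a b => ?_) (fun g a ha i j => ?_) (fun g M hM => ?_)
  · ext i j
    apply NuclearCorner.val_injective
    rw [Matrix.mul_apply, map_sum]
    have : ∀ k, NuclearCorner.val (f a i k * f b k j) = s 0 i * (a * (s k k * (b * s j 0))) :=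
      fun k => by
        change s 0 i * (a * s k 0) * (s 0 k * (b * s j 0)) = _
        rw [(hN 0 i).left, (hN k 0).mid, hsame']
    simp only [this, ← Finset.mul_sum, ← Finset.sum_mul, hsum, one_mul]
    rw [← (hN j 0).right]
    rfl
  · have := hA.mul_mem 0 _ _ (hs0 0 i) _ (hA.mul_mem g 0 _ ha _ (hs0 j 0))
    rwa [zero_add, add_zero] at this
  · change S M ∈ 𝒜 g
    rw [hS]
    refine Submodule.sum_mem _ fun i _ => Submodule.sum_mem _ fun j _ => ?_
    have := hA.mul_mem 0 _ _ (hs0 i 0) _ (hA.mul_mem g 0 _ (hM i j) _ (hs0 0 j))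
    rwa [zero_add, add_zero] at this

end Corner

/-! ### Classification -/

theorem mainTheorem4 {K : Type u} [Field K] [IsAlgClosed K] [CharZero K]
    {A : Type v} [NonAssocRing A] [Module K A] [IsScalarTower K A A] [SMulCommClass K A A]
    (𝒜 : ZMod 2 → Submodule K A)
    (hA : IsAntiassociativeQuasialgebra 𝒜)
    (hart : NeutralPartArtinian 𝒜)
    (hcross : IsQuasicrossedProduct 𝒜)
    (hsimple : IsGradedSimple 𝒜) :
    -- existence of one of the two models
    ((∃ (n : ℕ) (Δ : Type v) (_ : NonAssocRing Δ) (_ : Module K Δ)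
        (_ : IsScalarTower K Δ Δ) (_ : SMulCommClass K Δ Δ) (𝒟 : ZMod 2 → Submodule K Δ),
        0 < n ∧ IsDivisionAntiassociative 𝒟 ∧ GradedIso 𝒜 (matrixGrading n 𝒟)) ∨
      (∃ (n m : ℕ) (D : Type v) (_ : DivisionRing D) (_ : Algebra K D),
        0 < n ∧ 0 < m ∧ GradedIso 𝒜 (ChessMat.grading K n m D))) ∧
    -- the two models exclude each other
    (∀ (n : ℕ) (Δ : Type v) [NonAssocRing Δ] [Module K Δ]
        [IsScalarTower K Δ Δ] [SMulCommClass K Δ Δ] (𝒟 : ZMod 2 → Submodule K Δ)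
        (p q : ℕ) (D : Type v) [DivisionRing D] [Algebra K D],
        IsDivisionAntiassociative 𝒟 → GradedIso 𝒜 (matrixGrading n 𝒟) →
        ¬ GradedIso 𝒜 (ChessMat.grading K p q D)) ∧
    -- uniqueness of `n` and `Δ`
    (∀ (n n' : ℕ)
        (Δ : Type v) [NonAssocRing Δ] [Module K Δ]
        [IsScalarTower K Δ Δ] [SMulCommClass K Δ Δ] (𝒟 : ZMod 2 → Submodule K Δ)
        (Δ' : Type v) [NonAssocRing Δ'] [Module K Δ']
        [IsScalarTower K Δ' Δ'] [SMulCommClass K Δ' Δ'] (𝒟' : ZMod 2 → Submodule K Δ'),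
        IsDivisionAntiassociative 𝒟 → IsDivisionAntiassociative 𝒟' →
        GradedIso 𝒜 (matrixGrading n 𝒟) → GradedIso 𝒜 (matrixGrading n' 𝒟') →
        n = n' ∧ GradedIso 𝒟 𝒟') ∧
    -- uniqueness of `n`, `m` and `D`
    (∀ (n m n' m' : ℕ)
        (D : Type v) [DivisionRing D] [Algebra K D]
        (D' : Type v) [DivisionRing D'] [Algebra K D'],
        GradedIso 𝒜 (ChessMat.grading K n m D) → GradedIso 𝒜 (ChessMat.grading K n' m' D') →
        n = n' ∧ m = m' ∧ Nonempty (D ≃ₐ[K] D')) := by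
  have hnt : Nontrivial A := by
    obtain ⟨x, y, hxy⟩ := hsimple.sq_ne_zero
    exact ⟨_, _, hxy⟩
  refine ⟨?_, fun n Δ _ _ _ _ 𝒟 p q D _ _ hD hf =>
      not_gradedIso_chess_of_gradedIso_matrix hA hcross hD hf,
    fun n n' Δ _ _ _ _ 𝒟 Δ' _ _ _ _ 𝒟' hD hD' hf hf' =>
      eq_and_gradedIso_of_gradedIso_matrix hA hD hD' hf hf',
    fun n m n' m' D _ _ D' _ _ hf hf' =>
      eq_and_nonempty_algEquiv_of_gradedIso_chess hA hcross hf hf'⟩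
  have : Nontrivial hA.EvenPart :=
    ⟨0, 1, fun h0 => zero_ne_one (α := A) (congrArg (EvenPart.val hA) h0)⟩
  obtain ⟨u, r, h⟩ := exists_isOddUnit hA hcross
  have := EvenPart.isSemisimpleRing hA hart hsimple h
  obtain ⟨n, hn, D, _, _, ι, hι⟩ := exists_isMatrixBlock K hA.EvenPart
  rcases hι.one_eq_or hA hsimple h with hone | hadd
  · left
    let s : Fin n → Fin n → A := fun i j => EvenPart.val hA (ι (Matrix.single i j 1))
    have hs0 : ∀ i j, s i j ∈ 𝒜 0 := fun i j => EvenPart.val_mem _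
    have hmul : ∀ i j k l, s i j * s k l = if j = k then s i l else 0 := fun i j k l => by
      change EvenPart.val hA (ι _ * ι _) = _
      rw [← hι.map_mul]
      split_ifs with hjk
      · rw [hjk, Matrix.single_mul_single_same, one_mul]
      · rw [Matrix.single_mul_single_of_ne _ _ _ _ hjk, map_zero, map_zero]
    have hsum : ∑ i, s i i = 1 := by
      rw [← EvenPart.val_one hA, ← hone, ← map_sum, ← map_sum]
      congr 2
      ext i j
      simp [Matrix.sum_apply, Matrix.single_apply, Matrix.one_apply, ite_and]
    have hee : s 0 0 * s 0 0 = s 0 0 := by rw [hmul, if_pos rfl]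
    exact ⟨n, NuclearCorner K (hA.isNuclear (hs0 0 0)) hee, inferInstance, inferInstance,
      inferInstance, inferInstance, _, NeZero.pos n,
      isDivisionAntiassociative_nuclearCorner hA h hι hone _ hee rfl,
      gradedIso_matrix_nuclearCorner hA s hs0 hmul hsum _ hee⟩
  · right
    exact ⟨n, n, D, _, _, NeZero.pos n, NeZero.pos n,
      gradedIso_chess hA hι (h.isOddSwap hA (hι.one_mul_map 1) hadd)⟩
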